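/- Consider the Erlang-C (that is, $M/M/n$) system with $n \ge 1$ servers, arrival rate $\lambda > 0$, service rate $\mu > 0$ per server and no abandonment. The number $X(t)$ of customers in the system at time $t$ is the birth-death process on $\{0,1,2,\dots\}$ with birth rate $\lambda$ and death rate $\mu \min(k,n)$ in state $k$. Put $R = \lambda/\mu$; for $R < n$ the process is positive recurrent, and $X(\infty)$ denotes a random variable having its stationary distribution. Put $\tilde X(\infty) = (X(\infty) - R)/\sqrt{R}$, $\delta = 1/\sqrt{R}$, $\zeta = (R-n)/\sqrt{R}$ and $$b(x) = \big[(x+\zeta)^- - \zeta^-\big]\mu, \qquad x \in \mathbb{R},$$ where $x^- = \max(-x,0)$, and let $Y(\infty)$ be a random variable on $\mathbb{R}$ with density $\kappa \exp\big(\frac{1}{\mu}\int_0^x b(y)\,dy\big)$, where $\kappa > 0$ is the constant that makes the density integrate to one. Theorem. For every integer $m > 0$ there exists a constant $C(m)$, depending only on $m$, such that for all $n \ge 1$, $\lambda > 0$ and $\mu > 0$ satisfying $1 \le R < n$, the $m$-th moments of $\tilde X(\infty)$ and $Y(\infty)$ are finite and $$\big|\mathbb{E}\,\tilde X(\infty)^m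 - \mathbb{E}\,Y(\infty)^m\big| \le \Big(1 + \frac{1}{|\zeta|^{m-1}}\Big)\, C(m)\, \delta .$$ -/

import Mathlib

open MeasureTheory ProbabilityTheory
open scoped NNReal ENNReal

noncomputable section

namespace ErlangC

/-- Departure rate `d(k) = μ (k ∧ n)` when there are `k` customers, `n` servers and service
rate `μ` (no abandonment). -/
def deathRate (n : ℕ) (mu : ℝ) (k : ℕ) : ℝ := mu * (min k n : ℕ)

/-- Rate matrix of the birth-death process counting the customers in the system: up by one at
rate `lam`, from `k` down by one at rate `d(k)`. -/
def rate (n : ℕ) (lam mu : ℝ) (i j : ℕ) : ℝ :=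
  if j = i + 1 then lam
  else if i = j + 1 then deathRate n mu i
  else if i = j then -(lam + deathRate n mu i)
  else 0

/-- `P` is the transition semigroup of a continuous-time Markov chain on `ℕ` with rate matrix
`Q`: each `P t` is a Markov kernel, `P 0` is the identity, the Chapman-Kolmogorov equations hold,
and `d/dt P t i {j}` at `t = 0+` is `Q i j`. -/
structure IsTransitionSemigroup (Q : ℕ → ℕ → ℝ) (P : ℝ≥0 → Kernel ℕ ℕ) : Prop where
  markov : ∀ t, IsMarkovKernel (P t)
  zero : P 0 = Kernel.id
  add : ∀ s t, P (s + t) = P t ∘ₖ P s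
  deriv : ∀ i j : ℕ,
    HasDerivWithinAt (fun t : ℝ => (P t.toNNReal i).real {j}) (Q i j) (Set.Ici 0) 0

/-- `π` is a stationary distribution of the Erlang-C chain `X`, i.e. the law of `X(∞)`: a
probability measure on `ℕ` that is invariant under the transition semigroup of the chain. -/
def IsStationaryLaw (n : ℕ) (lam mu : ℝ) (π : Measure ℕ) : Prop :=
  IsProbabilityMeasure π ∧
    ∃ P : ℝ≥0 → Kernel ℕ ℕ, IsTransitionSemigroup (rate n lam mu) P ∧
      ∀ t, Kernel.Invariant (P t) π

/-- Offered load `R = λ / μ`. -/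
def load (lam mu : ℝ) : ℝ := lam / mu

/-- `δ = 1 / √R`. -/
def delta (lam mu : ℝ) : ℝ := 1 / √(load lam mu)

/-- `ζ = (R - n) / √R`. -/
def zeta (n : ℕ) (lam mu : ℝ) : ℝ := (load lam mu - n) / √(load lam mu)

/-- The law of `(X - R) / √R` when `X` has law `π`. -/
def scaledLaw (lam mu : ℝ) (π : Measure ℕ) : Measure ℝ :=
  π.map (fun k : ℕ => ((k : ℝ) - load lam mu) / √(load lam mu))

/-- The drift `b(x) = [(x + ζ)⁻ - ζ⁻] μ`, where `x⁻ = max (-x) 0`. -/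
def drift (n : ℕ) (lam mu : ℝ) (x : ℝ) : ℝ :=
  (max (-(x + zeta n lam mu)) 0 - max (-(zeta n lam mu)) 0) * mu

/-- The unnormalized density `exp ((1/μ) ∫₀ˣ b(y) dy)`. -/
def weight (n : ℕ) (lam mu : ℝ) (x : ℝ) : ℝ :=
  Real.exp ((1 / mu) * ∫ y in (0 : ℝ)..x, drift n lam mu y)

/-- The normalizing constant `κ`. -/
def normConst (n : ℕ) (lam mu : ℝ) : ℝ := (∫ x, weight n lam mu x)⁻¹

/-- The law of `Y(∞)`, with density `κ exp ((1/μ) ∫₀ˣ b(y) dy)`. -/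
def diffusionLaw (n : ℕ) (lam mu : ℝ) : Measure ℝ :=
  volume.withDensity (fun x => ENNReal.ofReal (normConst n lam mu * weight n lam mu x))

end ErlangC

end

/-! Write r = √R, δ = 1/r and z = |ζ| = (n - R)/√R. Both laws are split at z, where the drift
changes form: the chain into the states `≤ n` and `> n`, the diffusion into a Gaussian piece on (-∞,
z] and an exponential piece of rate z on (z, ∞). On each piece the moments of the chain satisfy a
recursion that is the corresponding integration-by-parts recursion of the diffusion up to an error
of order δ.

For the chain, invariance under the semigroup gives πQ = 0 and hence detailed balance. Summation by
parts against xᵏ then yields `Balanced.lowerMoment_rec` and `Balanced.upperMoment_rec`. Expanding (x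
- δ)ᵏ and keeping the leading terms gives a_{k+2} ≈ (k+1) a_k - P z^{k+2} below and b_{k+1} ≈ P
z^{k+1} + (k+1) b_k / z above, where P is the mass of the states above n. The diffusion satisfies
these relations exactly, with its own tail mass q in place of P.

It remains to compare P with q. Both have the form 1/(1 + z M), where M is g = ∫ (1 + s/r)ⁿ e^{-rs}
ds for the chain (`Balanced.lowerMoment_zero`) and G = ∫ e^{zs - s²/2} ds for the diffusion. The
logarithms of the integrands differ by O(δ s²(z + s)), so g - G is of order δ with polynomial
factors in z. For large z these are absorbed by the exponential growth of g and G; for small z both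
are bounded. Moreover P - q is proportional to z(g - G), which leaves a spare factor z
(`delay_bounds`).

In the upper recursion every step divides by z and costs a factor y = max(1, 1/z). The spare factor
z in P - q pays for one of them, so the m-th moment loses y^{m-1} rather than y^m; this is the
source of 1 + 1/|ζ|^{m-1}. -/

namespace ErlangC
open Filter Topology

/-! ### Invariance under the semigroup implies detailed balance. -/

section Semigroup

variable {Q : ℕ → ℕ → ℝ} {P : ℝ≥0 → Kernel ℕ ℕ}

/-- In Chapman-Kolmogorov, keep only the intermediate state i. -/
theorem IsTransitionSemigroup.mul_le (h : IsTransitionSemigroup Q P) (s t : ℝ≥0) (i : ℕ) :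
    (P s i).real {i} * (P t i).real {i} ≤ (P (s + t) i).real {i} := by
  have := h.markov
  have key : P t i {i} * P s i {i} ≤ P (s + t) i {i} := by
    rw [h.add, Kernel.comp_apply' _ _ _ (measurableSet_singleton i)]
    calc P t i {i} * P s i {i} = ∫⁻ b in {i}, P t b {i} ∂(P s i) := by
          rw [lintegral_singleton]
      _ ≤ _ := setLIntegral_le_lintegral _ _
  have := ENNReal.toReal_mono (measure_ne_top _ _) key
  rw [ENNReal.toReal_mul, mul_comm] at this
  exact this

theorem IsTransitionSemigroup.one_sub_nsmul_le (h : IsTransitionSemigroup Q P) (t : ℝ≥0)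
    (i k : ℕ) : 1 - (P (k • t) i).real {i} ≤ k * (1 - (P t i).real {i}) := by
  have := h.markov
  induction k with
  | zero => simp [h.zero, Kernel.id_apply, measureReal_def]
  | succ k ih =>
    have h1 := h.mul_le (k • t) t i
    rw [← succ_nsmul] at h1
    have h2 : (P (k • t) i).real {i} ≤ 1 := measureReal_le_one
    have h3 : (P t i).real {i} ≤ 1 := measureReal_le_one
    push_cast
    nlinarith [mul_nonneg (sub_nonneg.2 h2) (sub_nonneg.2 h3)]

theorem IsTransitionSemigroup.tendsto_slope (h : IsTransitionSemigroup Q P) (i j : ℕ) :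
    Tendsto (fun t : ℝ => t⁻¹ * ((P t.toNNReal i).real {j} - (P 0 i).real {j})) (𝓝[>] 0)
      (𝓝 (Q i j)) := by
  have := (hasDerivWithinAt_iff_tendsto_slope.1 (h.deriv i j)).mono_left
    (nhdsWithin_mono 0 (s := Set.Ioi (0 : ℝ)) (fun x hx => ⟨le_of_lt (Set.mem_Ioi.1 hx), ne_of_gt (Set.mem_Ioi.1 hx)⟩))
  refine this.congr (fun t => ?_)
  simp [slope]

theorem IsTransitionSemigroup.id_real (h : IsTransitionSemigroup Q P) (i j : ℕ) :
    (P 0 i).real {j} = if i = j then 1 else 0 := by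
  rw [h.zero, Kernel.id_apply, measureReal_def, Measure.dirac_apply' _ (measurableSet_singleton j)]
  by_cases hij : i = j <;> simp [hij, Set.indicator]

/-- Cutting [0, t] into k + 1 equal pieces, the loss 1 - P(i, i) is at most k + 1 times its value on
one piece; as k → ∞ this tends to the derivative at 0 times t. Thus the derivative at 0 controls all
times. -/
theorem IsTransitionSemigroup.one_sub_le (h : IsTransitionSemigroup Q P) {t : ℝ} (ht : 0 < t)
    (i : ℕ) : 1 - (P t.toNNReal i).real {i} ≤ t * (-Q i i) := by
  have h0 : Tendsto (fun k : ℕ => t / ((k : ℝ) + 1)) atTop (𝓝[>] 0) := by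
    refine tendsto_nhdsWithin_iff.2 ⟨?_, Eventually.of_forall fun k => ?_⟩
    · have := tendsto_one_div_add_atTop_nhds_zero_nat.const_mul t
      simpa [div_eq_mul_inv] using this
    · exact Set.mem_Ioi.2 (by positivity)
  have h1 := ((h.tendsto_slope i i).comp h0).const_mul (-t)
  have h2 : -t * Q i i = t * (-Q i i) := by ring
  rw [h2] at h1
  refine ge_of_tendsto h1 (Eventually.of_forall fun k => ?_)
  have h3 := h.one_sub_nsmul_le (t / ((k : ℝ) + 1)).toNNReal i (k + 1)
  have h4 : (k + 1) • (t / ((k : ℝ) + 1)).toNNReal = t.toNNReal := by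
    rw [nsmul_eq_mul, ← Real.toNNReal_natCast, ← Real.toNNReal_mul (by positivity)]
    congr 1
    push_cast
    field_simp
  rw [h4] at h3
  refine h3.trans_eq ?_
  have hk : ((k : ℝ) + 1) ≠ 0 := by positivity
  simp only [Function.comp_apply, h.id_real]
  push_cast
  field_simp
  ring

/-- Off the diagonal, P t i {j} is at most the mass that has left i, so the diagonal estimate covers
every entry. -/
theorem IsTransitionSemigroup.abs_sub_le (h : IsTransitionSemigroup Q P) {t : ℝ} (ht : 0 < t)
    (i j : ℕ) : |(P t.toNNReal i).real {j} - (P 0 i).real {j}| ≤ t * (-Q i i) := by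
  have := h.markov
  refine le_trans ?_ (h.one_sub_le ht i)
  rw [h.id_real]
  by_cases hij : i = j
  · subst hij
    have h2 : (P t.toNNReal i).real {i} ≤ 1 := measureReal_le_one
    rw [if_pos rfl, abs_sub_comm, abs_of_nonneg (by linarith)]
  · rw [if_neg hij, sub_zero, abs_of_nonneg measureReal_nonneg]
    have h1 : (P t.toNNReal i).real ({i} ∪ {j}) = _ :=
      measureReal_union (by simpa using hij) (measurableSet_singleton j)
    have h2 : (P t.toNNReal i).real ({i} ∪ {j}) ≤ 1 := measureReal_le_one
    linarith

/-- The difference quotients of P t i {j} have π-integral zero by invariance and are bounded by c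
uniformly in i, so dominated convergence passes to t → 0. -/
theorem IsTransitionSemigroup.integral_rate_eq_zero (h : IsTransitionSemigroup Q P) {c : ℝ}
    (hc : ∀ i, -Q i i ≤ c) (π : Measure ℕ) [IsProbabilityMeasure π]
    (hπ : ∀ t, Kernel.Invariant (P t) π) (j : ℕ) : ∫ i, Q i j ∂π = 0 := by
  have := h.markov
  have hint : ∀ t : ℝ≥0, Integrable (fun i => (P t i).real {j}) π := fun t =>
    Integrable.of_bound (C := 1) (measurable_of_countable _).aestronglyMeasurable
      (Eventually.of_forall fun i => by
        rw [Real.norm_eq_abs, abs_of_nonneg measureReal_nonneg]; exact measureReal_le_one)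
  have hinv : ∀ t : ℝ≥0, ∫ i, (P t i).real {j} ∂π = π.real {j} := by
    intro t
    have h1 : π.bind (P t) = π := hπ t
    have h2 : π {j} = ∫⁻ i, P t i {j} ∂π := by
      conv_lhs => rw [← h1]
      rw [Measure.bind_apply (measurableSet_singleton j) (P t).measurable.aemeasurable]
    rw [measureReal_def, h2]
    exact integral_toReal (measurable_of_countable _).aemeasurable
      (Eventually.of_forall fun i => measure_lt_top _ _)
  have hlim : Tendsto (fun t : ℝ => ∫ i, t⁻¹ * ((P t.toNNReal i).real {j} - (P 0 i).real {j}) ∂π)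
      (𝓝[>] 0) (𝓝 (∫ i, Q i j ∂π)) := by
    refine tendsto_integral_filter_of_dominated_convergence (fun _ => c)
      (Eventually.of_forall fun t => (measurable_of_countable _).aestronglyMeasurable) ?_
      (integrable_const c) (Eventually.of_forall fun i => h.tendsto_slope i j)
    filter_upwards [self_mem_nhdsWithin] with t ht
    have ht' : (0 : ℝ) < t := ht
    refine Eventually.of_forall fun i => ?_
    rw [norm_mul, Real.norm_eq_abs, Real.norm_eq_abs, abs_of_pos (inv_pos.2 ht'),
      inv_mul_le_iff₀ ht']
    exact (h.abs_sub_le ht' i j).trans (mul_le_mul_of_nonneg_left (hc i) ht'.le)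
  refine tendsto_nhds_unique hlim (tendsto_const_nhds.congr fun t => ?_)
  rw [integral_const_mul, integral_sub (hint _) (hint _), hinv, hinv]
  simp

end Semigroup

theorem integral_nat_eq_sum (π : Measure ℕ) [IsProbabilityMeasure π] (f : ℕ → ℝ) (N : ℕ)
    (hf : ∀ i, N ≤ i → f i = 0) :
    ∫ i, f i ∂π = ∑ i ∈ Finset.range N, π.real {i} * f i := by
  have hs : ∀ i, i ∉ ((Finset.range N : Finset ℕ) : Set ℕ) → f i = 0 := fun i hi =>
    hf i (by simpa using hi)
  rw [← setIntegral_eq_integral_of_forall_compl_eq_zero hs, setIntegral_finset]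
  · simp [smul_eq_mul]
  · exact IntegrableOn.finset

/-- Death rates saturate at μ n, so the exit rates are bounded and πQ = 0 holds. Column j involves
only the states j - 1, j, j + 1, so induction turns global balance into balance across each cut. -/
theorem IsStationaryLaw.detailed_balance {n : ℕ} {lam mu : ℝ} (hmu : 0 < mu)
    {π : Measure ℕ} (h : IsStationaryLaw n lam mu π) (k : ℕ) :
    deathRate n mu (k + 1) * π.real {k + 1} = lam * π.real {k} := by
  obtain ⟨hp, P, hP, hinv⟩ := h
  have hc : ∀ i, -rate n lam mu i i ≤ lam + mu * n := by
    intro i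
    have h1 : mu * ((min i n : ℕ) : ℝ) ≤ mu * n :=
      mul_le_mul_of_nonneg_left (by exact_mod_cast min_le_right i n) hmu.le
    simp [rate, deathRate] at h1 ⊢
    linarith
  have hbal : ∀ j, ∑ i ∈ Finset.range (j + 2), π.real {i} * rate n lam mu i j = 0 := by
    intro j
    rw [← integral_nat_eq_sum π (fun i => rate n lam mu i j) (j + 2), hP.integral_rate_eq_zero hc π hinv]
    intro i hi
    simp only [rate]
    rw [if_neg (by omega), if_neg (by omega), if_neg (by omega)]
  induction k with
  | zero =>
    have := hbal 0
    simp [Finset.sum_range_succ, rate, deathRate] at this ⊢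
    linarith
  | succ k ih =>
    have := hbal (k + 1)
    rw [Finset.sum_range_succ, Finset.sum_range_succ, Finset.sum_range_succ,
      Finset.sum_eq_zero] at this
    · simp [rate] at this
      linarith
    · intro i hi
      have := Finset.mem_range.1 hi
      simp only [rate]
      rw [if_neg (by omega), if_neg (by omega), if_neg (by omega), mul_zero]


/-! ### Moment recursions of the chain below and above n. -/

/-- The scaled state `(i - R) / √R` with `r = √R`. -/
noncomputable def node (r : ℝ) (i : ℕ) : ℝ := (i - r ^ 2) / r

theorem node_succ_sub {r : ℝ} (hr : 0 < r) (i : ℕ) : node r (i + 1) - r⁻¹ = node r i := by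
  unfold node
  push_cast
  field_simp
  ring

theorem cast_eq_node {r : ℝ} (hr : 0 < r) (i : ℕ) : (i : ℝ) = r ^ 2 + r * node r i := by
  unfold node
  field_simp
  ring

/-- The detailed balance equations of the Erlang-C chain with offered load `r ^ 2`. -/
def Balanced (n : ℕ) (r : ℝ) (p : ℕ → ℝ) : Prop :=
  ∀ k, ((min (k + 1) n : ℕ) : ℝ) * p (k + 1) = r ^ 2 * p k

/-- The `k`-th scaled moment restricted to the states `≤ n`. -/
noncomputable def lowerMoment (n : ℕ) (r : ℝ) (p : ℕ → ℝ) (k : ℕ) : ℝ :=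
  ∑ i ∈ Finset.range (n + 1), node r i ^ k * p i

/-- The `k`-th scaled moment restricted to the states `> n`. -/
noncomputable def upperMoment (n : ℕ) (r : ℝ) (p : ℕ → ℝ) (k : ℕ) : ℝ :=
  ∑' i, node r (i + (n + 1)) ^ k * p (i + (n + 1))

section Chain

variable {n : ℕ} {r : ℝ} {p : ℕ → ℝ}

/-- For 1 ≤ i ≤ n one has i p(i) = r² p(i - 1), so the sum telescopes. It is the discrete form of
integrating (F · weight)' over (-∞, z]. -/
theorem Balanced.sum_lower (hp : Balanced n r p) (hr : 0 < r) (F : ℝ → ℝ) (N : ℕ) (hN : N ≤ n) :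
    ∑ i ∈ Finset.range (N + 1), (r ^ 2 * F (node r i) - i * F (node r i - r⁻¹)) * p i =
      r ^ 2 * F (node r N) * p N := by
  induction N with
  | zero => simp
  | succ N ih =>
    rw [Finset.sum_range_succ, ih (by omega), node_succ_sub hr]
    have := hp N
    rw [min_eq_left hN] at this
    linear_combination - F (node r N) * this

theorem sub_pow_eq_sum (x d : ℝ) (k : ℕ) :
    (x - d) ^ k = ∑ j ∈ Finset.range (k + 1), k.choose j * (-d) ^ (k - j) * x ^ j := by
  rw [sub_eq_add_neg, add_pow]
  exact Finset.sum_congr rfl fun j _ => by ring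

/-- The telescoped identity for F = xᵏ, divided by r, with i/r = r + x and (x - 1/r)ᵏ expanded. -/
theorem Balanced.lowerMoment_rec (hp : Balanced n r p) (hr : 0 < r) (k : ℕ) :
    r * lowerMoment n r p k - ∑ j ∈ Finset.range (k + 1), k.choose j * (-r⁻¹) ^ (k - j) *
      (r * lowerMoment n r p j + lowerMoment n r p (j + 1)) = r * p n * node r n ^ k := by
  have h := hp.sum_lower hr (fun x => x ^ k) n le_rfl
  have h1 : ∀ j, r * lowerMoment n r p j + lowerMoment n r p (j + 1) =
      ∑ i ∈ Finset.range (n + 1), (i / r * node r i ^ j) * p i := by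
    intro j
    unfold lowerMoment
    rw [Finset.mul_sum, ← Finset.sum_add_distrib]
    refine Finset.sum_congr rfl fun i _ => ?_
    rw [cast_eq_node hr i]
    field_simp
    ring
  have h2 : ∑ j ∈ Finset.range (k + 1), k.choose j * (-r⁻¹) ^ (k - j) *
      (r * lowerMoment n r p j + lowerMoment n r p (j + 1)) =
      ∑ i ∈ Finset.range (n + 1), (i / r * (node r i - r⁻¹) ^ k) * p i := by
    simp_rw [h1, sub_pow_eq_sum, Finset.mul_sum]
    rw [Finset.sum_comm]
    refine Finset.sum_congr rfl fun i _ => ?_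
    rw [Finset.sum_mul]
    exact Finset.sum_congr rfl fun j _ => by ring
  rw [h2, lowerMoment, Finset.mul_sum, ← Finset.sum_sub_distrib]
  have h3 : r * p n * node r n ^ k = r⁻¹ * (r ^ 2 * node r n ^ k * p n) := by
    field_simp
  rw [h3, ← h, Finset.mul_sum]
  refine Finset.sum_congr rfl fun i _ => ?_
  field_simp

theorem Balanced.upper (hp : Balanced n r p) (hn : r ^ 2 < n) (i : ℕ) :
    p (i + n) = p n * (r ^ 2 / n) ^ i := by
  have hn0 : (0 : ℝ) < n := lt_of_le_of_lt (sq_nonneg r) hn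
  induction i with
  | zero => simp
  | succ i ih =>
    have := hp (i + n)
    rw [min_eq_right (by omega), ih] at this
    rw [show i + 1 + n = i + n + 1 by ring, pow_succ]
    field_simp
    linear_combination this

theorem Balanced.summable (hp : Balanced n r p) (hr : 0 < r) (hn : r ^ 2 < n) (k : ℕ) :
    Summable fun i => node r i ^ k * p i := by
  have hn0 : (0 : ℝ) < n := lt_of_le_of_lt (sq_nonneg r) hn
  have hρ : ‖r ^ 2 / (n : ℝ)‖ < 1 := by
    rw [Real.norm_eq_abs, abs_of_nonneg (by positivity), div_lt_one hn0]
    exact hn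
  rw [← summable_nat_add_iff n]
  have h0 : ∀ i : ℕ, node r (i + n) = i * r⁻¹ - -node r n := by
    intro i
    unfold node
    push_cast
    field_simp
    ring
  simp_rw [hp.upper hn, h0, sub_pow_eq_sum, neg_neg, Finset.sum_mul]
  refine summable_sum fun j _ => ?_
  have := (summable_pow_mul_geometric_of_norm_lt_one j hρ).mul_left
    (k.choose j * node r n ^ (k - j) * r⁻¹ ^ j * p n)
  refine this.congr fun i => ?_
  rw [mul_pow]
  ring

/-- Above n the weights are geometric with ratio r²/n. Shifting the tail by one state replaces x by
x - 1/r and brings in the boundary state n; the factor r + `node r n` is n/r. -/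
theorem Balanced.upperMoment_rec (hp : Balanced n r p) (hr : 0 < r) (hn : r ^ 2 < n) (k : ℕ) :
    r * upperMoment n r p k - (r + node r n) * ∑ j ∈ Finset.range (k + 1),
      k.choose j * (-r⁻¹) ^ (k - j) * upperMoment n r p j = - (r * p n * node r n ^ k) := by
  have hn0 : (0 : ℝ) < n := lt_of_le_of_lt (sq_nonneg r) hn
  have hs : ∀ j, Summable fun i => node r (i + (n + 1)) ^ j * p (i + (n + 1)) := fun j =>
    (summable_nat_add_iff (n + 1)).2 (hp.summable hr hn j)
  have hs' : Summable fun i => node r (i + n) ^ k * p (i + n) :=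
    (summable_nat_add_iff n).2 (hp.summable hr hn k)
  have h1 : ∑ j ∈ Finset.range (k + 1), k.choose j * (-r⁻¹) ^ (k - j) * upperMoment n r p j =
      ∑' i, r ^ 2 / n * (node r (i + n) ^ k * p (i + n)) := by
    unfold upperMoment
    simp_rw [← tsum_mul_left]
    rw [← Summable.tsum_finsetSum fun j _ => (hs j).mul_left _]
    refine tsum_congr fun i => ?_
    have h3 : p (i + (n + 1)) = r ^ 2 / n * p (i + n) := by
      have := hp (i + n)
      rw [min_eq_right (by omega)] at this
      field_simp
      linear_combination this
    rw [← node_succ_sub hr (i + n), sub_pow_eq_sum, Finset.sum_mul, Finset.mul_sum]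
    refine Finset.sum_congr rfl fun j _ => ?_
    rw [h3, add_assoc]
    ring
  have h2 : ∑' i, node r (i + n) ^ k * p (i + n) = node r n ^ k * p n + upperMoment n r p k := by
    rw [hs'.tsum_eq_zero_add, zero_add, upperMoment]
    congr 1
    refine tsum_congr fun i => ?_
    rw [add_assoc, add_comm 1 n]
  have h4 := cast_eq_node hr n
  rw [h1, tsum_mul_left, h2]
  have h5 : (r + node r n) * (r ^ 2 / n) = r := by
    field_simp
    linear_combination - h4
  linear_combination - (node r n ^ k * p n + upperMoment n r p k) * h5

/-! ### Mass below n as a Laplace transform, and moments as sums. -/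

theorem Balanced.lower (hp : Balanced n r p) (hr : 0 < r) (j : ℕ) (hj : j ≤ n) :
    p (n - j) = p n * (n.descFactorial j * (r ^ 2)⁻¹ ^ j) := by
  induction j with
  | zero => simp
  | succ j ih =>
    have := hp (n - (j + 1))
    rw [show n - (j + 1) + 1 = n - j by omega, min_eq_left (by omega), ih (by omega)] at this
    rw [Nat.descFactorial_succ, pow_succ]
    push_cast
    field_simp at this ⊢
    linear_combination - this

/-- The Laplace transform of `s ^ k (1 + s / r) ^ n` at `r`. -/
noncomputable def gammaMoment (n : ℕ) (r : ℝ) (k : ℕ) : ℝ :=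
  ∫ s in Set.Ioi (0 : ℝ), s ^ k * ((1 + s / r) ^ n * Real.exp (-(r * s)))

theorem integrableOn_pow_mul_exp_neg (hr : 0 < r) (j : ℕ) :
    IntegrableOn (fun s : ℝ => s ^ j * Real.exp (-(r * s))) (Set.Ioi 0) := by
  have := integrableOn_rpow_mul_exp_neg_mul_rpow (p := 1) (s := j) (b := r)
    (by have : (0 : ℝ) ≤ j := Nat.cast_nonneg j
        linarith) one_pos hr
  refine this.congr_fun (fun x hx => ?_) measurableSet_Ioi
  simp

theorem integral_pow_mul_exp_neg (hr : 0 < r) (j : ℕ) :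
    ∫ s in Set.Ioi (0 : ℝ), s ^ j * Real.exp (-(r * s)) = j.factorial * r⁻¹ ^ (j + 1) := by
  have := Real.integral_rpow_mul_exp_neg_mul_Ioi (a := j + 1) (r := r) (by positivity) hr
  simp only [add_sub_cancel_right, Real.rpow_natCast, Real.Gamma_nat_eq_factorial] at this
  rw [this, mul_comm, one_div]
  congr 1
  exact_mod_cast Real.rpow_natCast r⁻¹ (j + 1)

theorem one_add_div_pow (n : ℕ) (r s : ℝ) :
    (1 + s / r) ^ n = ∑ j ∈ Finset.range (n + 1), n.choose j * r⁻¹ ^ j * s ^ j := by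
  rw [add_comm, add_pow]
  refine Finset.sum_congr rfl fun j _ => ?_
  rw [div_eq_mul_inv, mul_pow]
  ring

theorem integrableOn_gammaMoment (hr : 0 < r) (n k : ℕ) :
    IntegrableOn (fun s : ℝ => s ^ k * ((1 + s / r) ^ n * Real.exp (-(r * s)))) (Set.Ioi 0) := by
  simp_rw [one_add_div_pow, Finset.sum_mul, Finset.mul_sum]
  refine integrable_finsetSum _ fun j _ => ?_
  refine ((integrableOn_pow_mul_exp_neg hr (k + j)).const_mul (n.choose j * r⁻¹ ^ j)).congr ?_
  refine Eventually.of_forall fun s => ?_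
  simp only [pow_add]
  ring

/-- Expanding (1 + s/r)ⁿ and integrating termwise gives C(n, j) j! r^{-2j-1}, which is p(n - j) / (r
p(n)). The integral form makes the comparison with the Gaussian possible. -/
theorem Balanced.lowerMoment_zero (hp : Balanced n r p) (hr : 0 < r) :
    lowerMoment n r p 0 = r * p n * gammaMoment n r 0 := by
  have h1 : gammaMoment n r 0 =
      ∑ j ∈ Finset.range (n + 1), r⁻¹ * (n.descFactorial j * (r ^ 2)⁻¹ ^ j) := by
    unfold gammaMoment
    simp_rw [one_add_div_pow, Finset.sum_mul, Finset.mul_sum, pow_zero, one_mul, mul_assoc]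
    rw [integral_finsetSum]
    · refine Finset.sum_congr rfl fun j _ => ?_
      rw [integral_const_mul, integral_const_mul, integral_pow_mul_exp_neg hr,
        Nat.descFactorial_eq_factorial_mul_choose]
      push_cast
      rw [← inv_pow, ← pow_mul]
      ring
    · intro j _
      exact ((integrableOn_pow_mul_exp_neg hr j).const_mul _).const_mul _
  rw [h1, lowerMoment, ← Finset.sum_range_reflect, Finset.mul_sum]
  refine Finset.sum_congr rfl fun j hj => ?_
  have := Finset.mem_range.1 hj
  rw [show n + 1 - 1 - j = n - j by omega, hp.lower hr j (by omega)]
  field_simp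

theorem integrable_nat_iff (π : Measure ℕ) [IsFiniteMeasure π] (f : ℕ → ℝ)
    (hf : Summable fun i => |f i| * π.real {i}) : Integrable f π := by
  refine ⟨(measurable_of_countable f).aestronglyMeasurable, ?_⟩
  rw [hasFiniteIntegral_iff_enorm, lintegral_countable']
  have h : ∀ i, ‖f i‖ₑ * π {i} = ENNReal.ofReal (|f i| * π.real {i}) := by
    intro i
    rw [ENNReal.ofReal_mul (abs_nonneg _), measureReal_def,
      ENNReal.ofReal_toReal (measure_ne_top _ _), Real.enorm_eq_ofReal_abs]
  simp_rw [h]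
  exact hf.tsum_ofReal_lt_top

theorem Balanced.moments {π : Measure ℕ} [IsProbabilityMeasure π]
    (hp : Balanced n r fun i => π.real {i}) (hr : 0 < r) (hn : r ^ 2 < n) (k : ℕ) :
    Integrable (fun i => node r i ^ k) π ∧ ∫ i, node r i ^ k ∂π =
      lowerMoment n r (fun i => π.real {i}) k + upperMoment n r (fun i => π.real {i}) k := by
  have hs := hp.summable hr hn k
  have hi : Integrable (fun i => node r i ^ k) π := by
    refine integrable_nat_iff π _ (hs.abs.congr fun i => ?_)
    rw [abs_mul, abs_of_nonneg (measureReal_nonneg (μ := π) (s := {i}))]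
  refine ⟨hi, ?_⟩
  rw [integral_countable hi, lowerMoment, upperMoment, hs.sum_add_tsum_nat_add (n + 1)]
  exact tsum_congr fun i => by rw [smul_eq_mul, mul_comm]

end Chain


/-! ### Moments of the Gaussian and exponential pieces of the diffusion. -/

theorem integral_Ioi_deriv_eq_neg {f f' : ℝ → ℝ} {a : ℝ} (hd : ∀ x ∈ Set.Ici a, HasDerivAt f (f' x) x)
    (hf' : IntegrableOn f' (Set.Ioi a)) (hf : IntegrableOn f (Set.Ioi a)) :
    ∫ x in Set.Ioi a, f' x = - f a := by
  rw [integral_Ioi_of_hasDerivAt_of_tendsto' hd hf'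
    (tendsto_zero_of_hasDerivAt_of_integrableOn_Ioi
      (fun x hx => hd x (Set.mem_Ici.2 (Set.mem_Ioi.1 hx).le)) hf' hf), zero_sub]

theorem integral_Iic_deriv_eq {f f' : ℝ → ℝ} {a : ℝ} (hd : ∀ x, HasDerivAt f (f' x) x)
    (hf' : IntegrableOn f' (Set.Iic a)) (hf : IntegrableOn f (Set.Iic a)) :
    ∫ x in Set.Iic a, f' x = f a := by
  rw [integral_Iic_of_hasDerivAt_of_tendsto' (fun x _ => hd x) hf'
    (tendsto_zero_of_hasDerivAt_of_integrableOn_Iic (fun x _ => hd x) hf' hf), sub_zero]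

theorem integrable_pow_mul_gaussian (k : ℕ) :
    Integrable fun x : ℝ => x ^ k * Real.exp (-(x ^ 2 / 2)) := by
  have := integrable_rpow_mul_exp_neg_mul_sq (b := 1 / 2) (by norm_num) (s := k)
    (by have : (0 : ℝ) ≤ k := Nat.cast_nonneg k
        linarith)
  refine this.congr (Eventually.of_forall fun x => ?_)
  simp only [Real.rpow_natCast]
  congr 2
  ring

theorem hasDerivAt_gaussian (x : ℝ) :
    HasDerivAt (fun x : ℝ => Real.exp (-(x ^ 2 / 2))) (-(x * Real.exp (-(x ^ 2 / 2)))) x := by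
  have h : HasDerivAt (fun x : ℝ => -(x ^ 2 / 2)) (-x) x := by
    refine (((hasDerivAt_pow 2 x).div_const 2).neg).congr_deriv ?_
    simp
  refine (h.exp).congr_deriv ?_
  ring

/-- Integral of `x ^ k` against `exp (-x ^ 2 / 2)` over `(-∞, z]`. -/
noncomputable def gaussPart (z : ℝ) (k : ℕ) : ℝ :=
  ∫ x in Set.Iic z, x ^ k * Real.exp (-(x ^ 2 / 2))

theorem gaussPart_one (z : ℝ) : gaussPart z 1 = - Real.exp (-(z ^ 2 / 2)) := by
  unfold gaussPart
  refine integral_Iic_deriv_eq (f := fun x => -Real.exp (-(x ^ 2 / 2))) (fun x => ?_)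
    (integrable_pow_mul_gaussian 1).integrableOn ?_
  · refine ((hasDerivAt_gaussian x).neg).congr_deriv ?_
    simp
  · simpa using (integrable_pow_mul_gaussian 0).neg.integrableOn

theorem gaussPart_succ (z : ℝ) (k : ℕ) :
    gaussPart z (k + 2) = (k + 1) * gaussPart z k - z ^ (k + 1) * Real.exp (-(z ^ 2 / 2)) := by
  have h : ∫ x in Set.Iic z, ((k + 1) * (x ^ k * Real.exp (-(x ^ 2 / 2))) -
      x ^ (k + 2) * Real.exp (-(x ^ 2 / 2))) = z ^ (k + 1) * Real.exp (-(z ^ 2 / 2)) := by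
    refine integral_Iic_deriv_eq (f := fun x => x ^ (k + 1) * Real.exp (-(x ^ 2 / 2))) (fun x => ?_)
      (((integrable_pow_mul_gaussian k).const_mul _).sub
        (integrable_pow_mul_gaussian (k + 2))).integrableOn
      (integrable_pow_mul_gaussian (k + 1)).integrableOn
    refine ((hasDerivAt_pow (k + 1) x).mul (hasDerivAt_gaussian x)).congr_deriv ?_
    push_cast
    ring
  rw [integral_sub ((integrable_pow_mul_gaussian k).const_mul _).integrableOn
    (integrable_pow_mul_gaussian (k + 2)).integrableOn, integral_const_mul] at h
  unfold gaussPart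
  linarith

/-- Integral of `x ^ k` against `exp (z ^ 2 / 2 - z * x)` over `(z, ∞)`. -/
noncomputable def expPart (z : ℝ) (k : ℕ) : ℝ :=
  ∫ x in Set.Ioi z, x ^ k * Real.exp (z ^ 2 / 2 - z * x)

theorem integrableOn_expPart {z : ℝ} (hz : 0 < z) (k : ℕ) :
    IntegrableOn (fun x : ℝ => x ^ k * Real.exp (z ^ 2 / 2 - z * x)) (Set.Ioi z) := by
  have := ((integrableOn_pow_mul_exp_neg hz k).mono_set (Set.Ioi_subset_Ioi hz.le)).const_mul
    (Real.exp (z ^ 2 / 2))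
  refine this.congr (Eventually.of_forall fun x => ?_)
  simp only
  rw [sub_eq_add_neg, Real.exp_add]
  ring

theorem hasDerivAt_expTail (z x : ℝ) : HasDerivAt (fun x : ℝ => Real.exp (z ^ 2 / 2 - z * x))
    (-(z * Real.exp (z ^ 2 / 2 - z * x))) x := by
  have h : HasDerivAt (fun x : ℝ => z ^ 2 / 2 - z * x) (-z) x := by
    simpa using ((hasDerivAt_id x).const_mul z).const_sub (z ^ 2 / 2)
  refine (h.exp).congr_deriv ?_
  ring

theorem mul_expPart_zero {z : ℝ} (hz : 0 < z) : z * expPart z 0 = Real.exp (-(z ^ 2 / 2)) := by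
  have h : ∫ x in Set.Ioi z, -(z * Real.exp (z ^ 2 / 2 - z * x)) =
      - Real.exp (z ^ 2 / 2 - z * z) := by
    have hi : IntegrableOn (fun x : ℝ => Real.exp (z ^ 2 / 2 - z * x)) (Set.Ioi z) := by
      simpa using integrableOn_expPart hz 0
    exact integral_Ioi_deriv_eq_neg (fun x _ => hasDerivAt_expTail z x) (hi.const_mul z).neg hi
  rw [integral_neg, integral_const_mul] at h
  have h2 : z ^ 2 / 2 - z * z = -(z ^ 2 / 2) := by ring
  rw [h2] at h
  simp only [expPart, pow_zero, one_mul]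
  linarith

theorem mul_expPart_succ {z : ℝ} (hz : 0 < z) (k : ℕ) :
    z * expPart z (k + 1) = (k + 1) * expPart z k + z ^ (k + 1) * Real.exp (-(z ^ 2 / 2)) := by
  have h : ∫ x in Set.Ioi z, ((k + 1) * (x ^ k * Real.exp (z ^ 2 / 2 - z * x)) -
      z * (x ^ (k + 1) * Real.exp (z ^ 2 / 2 - z * x))) =
      - (z ^ (k + 1) * Real.exp (z ^ 2 / 2 - z * z)) := by
    refine integral_Ioi_deriv_eq_neg (f := fun x => x ^ (k + 1) * Real.exp (z ^ 2 / 2 - z * x))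
      (fun x _ => ?_)
      (((integrableOn_expPart hz k).const_mul _).sub
        ((integrableOn_expPart hz (k + 1)).const_mul _))
      (integrableOn_expPart hz (k + 1))
    refine ((hasDerivAt_pow (k + 1) x).mul (hasDerivAt_expTail z x)).congr_deriv ?_
    push_cast
    ring
  have h2 : z ^ 2 / 2 - z * z = -(z ^ 2 / 2) := by ring
  rw [integral_sub ((integrableOn_expPart hz k).const_mul _)
    ((integrableOn_expPart hz (k + 1)).const_mul _), integral_const_mul, integral_const_mul, h2] at h
  unfold expPart
  linarith

/-- Integral of `s ^ k * exp (z * s - s ^ 2 / 2)` over the positive half-line. -/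
noncomputable def gaussMoment (z : ℝ) (k : ℕ) : ℝ :=
  ∫ s in Set.Ioi (0 : ℝ), s ^ k * Real.exp (z * s - s ^ 2 / 2)

/-- Substitute x = z - s, so that -x²/2 = -z²/2 + zs - s²/2. -/
theorem gaussPart_zero (z : ℝ) :
    gaussPart z 0 = Real.exp (-(z ^ 2 / 2)) * gaussMoment z 0 := by
  unfold gaussPart gaussMoment
  rw [← integral_indicator measurableSet_Iic, ← integral_sub_left_eq_self _ volume z,
    ← integral_const_mul, ← integral_Ici_eq_integral_Ioi, ← integral_indicator measurableSet_Ici]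
  refine integral_congr_ae (Eventually.of_forall fun s => ?_)
  by_cases hs : 0 ≤ s
  · simp only [Set.indicator, Set.mem_Iic, Set.mem_Ici, hs, if_true, pow_zero, one_mul]
    rw [if_pos (by linarith), ← Real.exp_add]
    congr 1
    ring
  · simp only [Set.indicator, Set.mem_Iic, Set.mem_Ici, hs, if_false]
    rw [if_neg (by linarith)]

section Weight

variable {n : ℕ} {lam mu z : ℝ}

/-- With ζ = -z the drift is linear up to z and constant afterwards, hence the Gaussian and
exponential pieces of the weight. -/
theorem drift_eq (hz : 0 ≤ z) (hzeta : zeta n lam mu = -z) (x : ℝ) :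
    drift n lam mu x = - min x z * mu := by
  unfold drift
  rw [hzeta, neg_neg, max_eq_left hz]
  rcases le_total x z with h | h
  · rw [max_eq_left (by linarith), min_eq_left h]; ring
  · rw [max_eq_right (by linarith), min_eq_right h]; ring

theorem weight_eq (hmu : 0 < mu) (hz : 0 ≤ z) (hzeta : zeta n lam mu = -z) (x : ℝ) :
    weight n lam mu x = Real.exp (- ∫ y in (0 : ℝ)..x, min y z) := by
  unfold weight
  simp_rw [drift_eq hz hzeta]
  rw [intervalIntegral.integral_mul_const, intervalIntegral.integral_neg]
  congr 1
  field_simp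

theorem weight_of_le (hmu : 0 < mu) (hz : 0 ≤ z) (hzeta : zeta n lam mu = -z) {x : ℝ}
    (hx : x ≤ z) : weight n lam mu x = Real.exp (-(x ^ 2 / 2)) := by
  rw [weight_eq hmu hz hzeta, intervalIntegral.integral_congr (g := fun y => y), integral_id]
  · simp
  · intro y hy
    have := (Set.mem_uIcc.1 hy)
    refine min_eq_left ?_
    rcases this with h | h <;> linarith [h.1, h.2]

theorem weight_of_ge (hmu : 0 < mu) (hz : 0 ≤ z) (hzeta : zeta n lam mu = -z) {x : ℝ}
    (hx : z ≤ x) : weight n lam mu x = Real.exp (z ^ 2 / 2 - z * x) := by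
  have hc : Continuous fun y : ℝ => min y z := by fun_prop
  have h1 : ∫ y in (0 : ℝ)..z, min y z = ∫ y in (0 : ℝ)..z, y := by
    refine intervalIntegral.integral_congr fun y hy => ?_
    rw [Set.uIcc_of_le hz] at hy
    exact min_eq_left hy.2
  have h2 : ∫ y in z..x, min y z = ∫ y in z..x, z := by
    refine intervalIntegral.integral_congr fun y hy => ?_
    rw [Set.uIcc_of_le hx] at hy
    exact min_eq_right hy.1
  rw [weight_eq hmu hz hzeta, ← intervalIntegral.integral_add_adjacent_intervals
    (hc.intervalIntegrable 0 z) (hc.intervalIntegrable z x), h1, h2, integral_id,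
    intervalIntegral.integral_const]
  congr 1
  rw [smul_eq_mul]
  ring

theorem integrable_pow_mul_weight (hmu : 0 < mu) (hz : 0 < z) (hzeta : zeta n lam mu = -z) (k : ℕ) :
    Integrable (fun x => x ^ k * weight n lam mu x) ∧
      ∫ x, x ^ k * weight n lam mu x = gaussPart z k + expPart z k := by
  have h1 : ∀ x ∈ Set.Iic z, x ^ k * Real.exp (-(x ^ 2 / 2)) = x ^ k * weight n lam mu x :=
    fun x hx => by rw [weight_of_le hmu hz.le hzeta hx]
  have h2 : ∀ x ∈ Set.Ioi z, x ^ k * Real.exp (z ^ 2 / 2 - z * x) = x ^ k * weight n lam mu x :=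
    fun x hx => by rw [weight_of_ge hmu hz.le hzeta (le_of_lt (Set.mem_Ioi.1 hx))]
  have i1 : IntegrableOn (fun x => x ^ k * weight n lam mu x) (Set.Iic z) :=
    (integrable_pow_mul_gaussian k).integrableOn.congr_fun h1 measurableSet_Iic
  have i2 : IntegrableOn (fun x => x ^ k * weight n lam mu x) (Set.Ioi z) :=
    (integrableOn_expPart hz k).congr_fun h2 measurableSet_Ioi
  have i : Integrable (fun x => x ^ k * weight n lam mu x) := by
    rw [← integrableOn_univ, ← Set.Iic_union_Ioi (a := z)]
    exact i1.union i2
  refine ⟨i, ?_⟩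
  rw [← intervalIntegral.integral_Iic_add_Ioi i1 i2, gaussPart, expPart,
    setIntegral_congr_fun measurableSet_Iic h1, setIntegral_congr_fun measurableSet_Ioi h2]

theorem normConst_eq (hmu : 0 < mu) (hz : 0 < z) (hzeta : zeta n lam mu = -z) :
    normConst n lam mu = (gaussPart z 0 + expPart z 0)⁻¹ := by
  have := (integrable_pow_mul_weight hmu hz hzeta 0).2
  simp only [pow_zero, one_mul] at this
  rw [normConst, this]

theorem gaussMoment_nonneg (z : ℝ) (k : ℕ) : 0 ≤ gaussMoment z k :=
  setIntegral_nonneg measurableSet_Ioi fun s hs => by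
    have : (0 : ℝ) < s := hs
    positivity

theorem gaussPart_add_expPart_pos (hz : 0 < z) : 0 < gaussPart z 0 + expPart z 0 := by
  have h1 := mul_expPart_zero hz
  have h2 : 0 < expPart z 0 := by
    by_contra h
    have : z * expPart z 0 ≤ 0 := mul_nonpos_of_nonneg_of_nonpos hz.le (not_lt.1 h)
    rw [h1] at this
    exact absurd this (not_le.2 (Real.exp_pos _))
  rw [gaussPart_zero]
  have := gaussMoment_nonneg z 0
  positivity

theorem measurable_weight (hmu : 0 < mu) (hz : 0 < z) (hzeta : zeta n lam mu = -z) :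
    Measurable (weight n lam mu) := by
  have : weight n lam mu = fun x => if x ≤ z then Real.exp (-(x ^ 2 / 2)) else
      Real.exp (z ^ 2 / 2 - z * x) := by
    ext x
    split_ifs with h
    · exact weight_of_le hmu hz.le hzeta h
    · exact weight_of_ge hmu hz.le hzeta (not_le.1 h).le
  rw [this]
  exact Measurable.ite measurableSet_Iic (by fun_prop) (by fun_prop)

theorem diffusionLaw_moments (hmu : 0 < mu) (hz : 0 < z) (hzeta : zeta n lam mu = -z) (k : ℕ) :
    Integrable (fun x : ℝ => x ^ k) (diffusionLaw n lam mu) ∧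
      ∫ x, x ^ k ∂(diffusionLaw n lam mu) =
        (gaussPart z 0 + expPart z 0)⁻¹ * (gaussPart z k + expPart z k) := by
  have hpos := gaussPart_add_expPart_pos hz
  have hκ := normConst_eq hmu hz hzeta
  have hm : Measurable fun x => ENNReal.ofReal (normConst n lam mu * weight n lam mu x) :=
    ((measurable_weight hmu hz hzeta).const_mul _).ennreal_ofReal
  have ht : ∀ x, (ENNReal.ofReal (normConst n lam mu * weight n lam mu x)).toReal =
      (gaussPart z 0 + expPart z 0)⁻¹ * weight n lam mu x := by
    intro x
    rw [hκ, ENNReal.toReal_ofReal]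
    exact mul_nonneg (inv_nonneg.2 hpos.le) (Real.exp_pos _).le
  obtain ⟨hi, he⟩ := integrable_pow_mul_weight hmu hz hzeta k
  unfold diffusionLaw
  constructor
  · rw [integrable_withDensity_iff hm (Eventually.of_forall fun _ => ENNReal.ofReal_lt_top)]
    refine (hi.const_mul (gaussPart z 0 + expPart z 0)⁻¹).congr (Eventually.of_forall fun x => ?_)
    simp only [ht]
    ring
  · rw [integral_withDensity_eq_integral_toReal_smul hm
      (Eventually.of_forall fun _ => ENNReal.ofReal_lt_top), ← he, ← integral_const_mul]
    refine integral_congr_ae (Eventually.of_forall fun x => ?_)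
    simp only [ht, smul_eq_mul]
    ring

theorem isProbabilityMeasure_diffusionLaw (hmu : 0 < mu) (hz : 0 < z)
    (hzeta : zeta n lam mu = -z) : IsProbabilityMeasure (diffusionLaw n lam mu) := by
  have hpos := gaussPart_add_expPart_pos hz
  obtain ⟨hi, he⟩ := diffusionLaw_moments hmu hz hzeta 0
  simp only [pow_zero] at hi he
  rw [inv_mul_cancel₀ hpos.ne', integral_const, smul_eq_mul, mul_one] at he
  constructor
  rw [← ENNReal.toReal_eq_one_iff]
  exact he

end Weight


/-! ### Comparison of the two delay probabilities. -/

theorem integrableOn_gaussMoment (z : ℝ) (k : ℕ) :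
    IntegrableOn (fun s : ℝ => s ^ k * Real.exp (z * s - s ^ 2 / 2)) (Set.Ioi 0) := by
  have h := (integrable_rpow_mul_exp_neg_mul_sq (b := 1 / 4) (by norm_num) (s := k)
    (by have : (0 : ℝ) ≤ k := Nat.cast_nonneg k
        linarith)).integrableOn (s := Set.Ioi 0)
  refine Integrable.mono' (h.const_mul (Real.exp (z ^ 2))) (by fun_prop) ?_
  refine (ae_restrict_iff' measurableSet_Ioi).2 (Eventually.of_forall fun s hs => ?_)
  have hs' : (0 : ℝ) < s := hs
  rw [Real.norm_eq_abs, abs_of_nonneg (by positivity), Real.rpow_natCast, mul_left_comm,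
    ← Real.exp_add]
  refine mul_le_mul_of_nonneg_left (Real.exp_le_exp.2 ?_) (by positivity)
  -- This is zs ≤ z² + s²/4, which leaves half of the Gaussian decay.
  nlinarith [sq_nonneg (z - s / 2)]

theorem hasDerivAt_gaussMoment (z s : ℝ) :
    HasDerivAt (fun s : ℝ => Real.exp (z * s - s ^ 2 / 2))
      ((z - s) * Real.exp (z * s - s ^ 2 / 2)) s := by
  have h : HasDerivAt (fun s : ℝ => z * s - s ^ 2 / 2) (z - s) s := by
    refine (((hasDerivAt_id s).const_mul z).sub ((hasDerivAt_pow 2 s).div_const 2)).congr_deriv ?_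
    simp
  refine h.exp.congr_deriv ?_
  ring

theorem gaussMoment_one (z : ℝ) : gaussMoment z 1 = z * gaussMoment z 0 + 1 := by
  have h : ∫ s in Set.Ioi (0 : ℝ), (z * (s ^ 0 * Real.exp (z * s - s ^ 2 / 2)) -
      s ^ 1 * Real.exp (z * s - s ^ 2 / 2)) = -Real.exp (z * 0 - 0 ^ 2 / 2) := by
    refine integral_Ioi_deriv_eq_neg (f := fun s => Real.exp (z * s - s ^ 2 / 2))
      (fun s _ => ?_) (((integrableOn_gaussMoment z 0).const_mul _).sub
        (integrableOn_gaussMoment z 1)) (by simpa using integrableOn_gaussMoment z 0)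
    refine (hasDerivAt_gaussMoment z s).congr_deriv ?_
    ring
  rw [integral_sub ((integrableOn_gaussMoment z 0).const_mul _) (integrableOn_gaussMoment z 1),
    integral_const_mul] at h
  norm_num at h
  unfold gaussMoment
  norm_num
  linarith

theorem setIntegral_combination {f g h : ℝ → ℝ} {S : Set ℝ} (hf : IntegrableOn f S)
    (hg : IntegrableOn g S) (hh : IntegrableOn h S) (a b : ℝ) :
    ∫ s in S, (a * f s + b * g s - h s) =
      a * (∫ s in S, f s) + b * (∫ s in S, g s) - ∫ s in S, h s := by
  have h1 : IntegrableOn (fun s => a * f s + b * g s) S := (hf.const_mul a).add (hg.const_mul b)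
  rw [integral_sub h1 hh, integral_add (hf.const_mul a) (hg.const_mul b), integral_const_mul,
    integral_const_mul]

theorem gaussMoment_succ (z : ℝ) (k : ℕ) :
    gaussMoment z (k + 2) = z * gaussMoment z (k + 1) + (k + 1) * gaussMoment z k := by
  have i0 := integrableOn_gaussMoment z k
  have i1 := integrableOn_gaussMoment z (k + 1)
  have i2 := integrableOn_gaussMoment z (k + 2)
  have h : ∫ s in Set.Ioi (0 : ℝ), ((k + 1) * (s ^ k * Real.exp (z * s - s ^ 2 / 2)) +
      z * (s ^ (k + 1) * Real.exp (z * s - s ^ 2 / 2)) -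
      s ^ (k + 2) * Real.exp (z * s - s ^ 2 / 2)) =
      -(0 ^ (k + 1) * Real.exp (z * 0 - 0 ^ 2 / 2)) := by
    refine integral_Ioi_deriv_eq_neg (f := fun s => s ^ (k + 1) * Real.exp (z * s - s ^ 2 / 2))
      (fun s _ => ?_) (((i0.const_mul _).add (i1.const_mul _)).sub i2) i1
    refine ((hasDerivAt_pow (k + 1) s).mul (hasDerivAt_gaussMoment z s)).congr_deriv ?_
    push_cast
    ring
  rw [setIntegral_combination i0 i1 i2,
    zero_pow (by omega), zero_mul, neg_zero] at h
  unfold gaussMoment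
  linarith

section Comparison

variable {n : ℕ} {r z : ℝ}

/-- The power n + 1 cancels the denominator 1 + s/r of the logarithmic derivative, so the recursions
below stay polynomial. -/
theorem hasDerivAt_gammaMoment (hr : 0 < r) (s : ℝ) :
    HasDerivAt (fun s : ℝ => (1 + s / r) ^ (n + 1) * Real.exp (-(r * s)))
      ((r⁻¹ + node r n - s) * ((1 + s / r) ^ n * Real.exp (-(r * s)))) s := by
  have h1 : HasDerivAt (fun s : ℝ => 1 + s / r) r⁻¹ s := by
    simpa using ((hasDerivAt_id s).div_const r).const_add 1
  have h2 : HasDerivAt (fun s : ℝ => -(r * s)) (-r) s := by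
    exact ((hasDerivAt_id s).const_mul r).neg.congr_deriv (by simp)
  refine ((h1.pow (n + 1)).mul h2.exp).congr_deriv ?_
  rw [Nat.add_sub_cancel]
  push_cast
  rw [cast_eq_node hr n]
  simp only [Pi.pow_apply]
  rw [pow_succ (1 + s / r) n]
  generalize (1 + s / r) ^ n = u
  field_simp
  ring

theorem gammaMoment_one (hr : 0 < r) :
    gammaMoment n r 1 = (node r n + r⁻¹) * gammaMoment n r 0 + 1 := by
  have i0 := integrableOn_gammaMoment hr n 0
  have i1 := integrableOn_gammaMoment hr n 1
  have h : ∫ s in Set.Ioi (0 : ℝ),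
      ((r⁻¹ + node r n) * (s ^ 0 * ((1 + s / r) ^ n * Real.exp (-(r * s)))) -
      s ^ 1 * ((1 + s / r) ^ n * Real.exp (-(r * s)))) =
      -((1 + 0 / r) ^ (n + 1) * Real.exp (-(r * 0))) := by
    refine integral_Ioi_deriv_eq_neg
      (f := fun s : ℝ => (1 + s / r) ^ (n + 1) * Real.exp (-(r * s)))
      (fun s _ => ?_) ((i0.const_mul _).sub i1)
      (by simpa using integrableOn_gammaMoment hr (n + 1) 0)
    refine (hasDerivAt_gammaMoment hr s).congr_deriv ?_
    ring
  rw [integral_sub (i0.const_mul _) i1, integral_const_mul] at h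
  norm_num at h
  unfold gammaMoment
  norm_num
  linarith

theorem gammaMoment_succ (hr : 0 < r) (k : ℕ) :
    gammaMoment n r (k + 2) = (node r n + (k + 2) * r⁻¹) * gammaMoment n r (k + 1) +
      (k + 1) * gammaMoment n r k := by
  have i0 := integrableOn_gammaMoment hr n k
  have i1 := integrableOn_gammaMoment hr n (k + 1)
  have i2 := integrableOn_gammaMoment hr n (k + 2)
  have h : ∫ s in Set.Ioi (0 : ℝ),
      ((k + 1) * (s ^ k * ((1 + s / r) ^ n * Real.exp (-(r * s)))) +
      (node r n + (k + 2) * r⁻¹) * (s ^ (k + 1) * ((1 + s / r) ^ n * Real.exp (-(r * s)))) -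
      s ^ (k + 2) * ((1 + s / r) ^ n * Real.exp (-(r * s)))) =
      -(0 ^ (k + 1) * ((1 + 0 / r) ^ (n + 1) * Real.exp (-(r * 0)))) := by
    refine integral_Ioi_deriv_eq_neg
      (f := fun s => s ^ (k + 1) * ((1 + s / r) ^ (n + 1) * Real.exp (-(r * s))))
      (fun s _ => ?_) (((i0.const_mul _).add (i1.const_mul _)).sub i2)
      (integrableOn_gammaMoment hr (n + 1) (k + 1))
    refine ((hasDerivAt_pow (k + 1) s).mul (hasDerivAt_gammaMoment hr s)).congr_deriv ?_
    push_cast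
    ring
  rw [setIntegral_combination i0 i1 i2,
    zero_pow (by omega), zero_mul, neg_zero] at h
  unfold gammaMoment
  linarith

theorem gammaMoment_nonneg (hr : 0 < r) (n k : ℕ) : 0 ≤ gammaMoment n r k :=
  setIntegral_nonneg measurableSet_Ioi fun s hs => by
    have : (0 : ℝ) < s := hs
    positivity

/-- The pointwise error carries the weight s²(z + s), hence this combination. Taking d = 1/r covers
the chain and d = 0 the Gaussian; 14 = 3 + 11 from the bounds on M 2 and M 3. -/
theorem third_moment_le {d : ℝ} {M : ℕ → ℝ} (hz : 0 ≤ z) (hd1 : d ≤ 1)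
    (hM : ∀ k, 0 ≤ M k) (h1 : M 1 = (z + d) * M 0 + 1)
    (h2 : ∀ k : ℕ, M (k + 2) = (z + (k + 2) * d) * M (k + 1) + (k + 1) * M k) :
    z * M 2 + M 3 ≤ 14 * (1 + z) ^ 3 * (1 + M 0) := by
  have e2 := h2 0
  have e3 := h2 1
  norm_num at e2 e3
  have m0 := hM 0
  have m1 := hM 1
  have m2 := hM 2
  have b1 : M 1 ≤ (1 + z) * (1 + M 0) := by
    rw [h1]; nlinarith [mul_nonneg (sub_nonneg.2 hd1) m0]
  have b2 : M 2 ≤ 3 * (1 + z) ^ 2 * (1 + M 0) := by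
    have : (z + 2 * d) * M 1 ≤ (2 * (1 + z)) * ((1 + z) * (1 + M 0)) :=
      mul_le_mul (by linarith) b1 m1 (by positivity)
    have : M 0 ≤ (1 + z) ^ 2 * (1 + M 0) := by nlinarith [mul_nonneg hz m0, sq_nonneg z]
    rw [e2]; linarith
  have b3 : M 3 ≤ 11 * (1 + z) ^ 3 * (1 + M 0) := by
    have c1 : (z + (1 + 2) * d) * M 2 ≤ (3 * (1 + z)) * (3 * (1 + z) ^ 2 * (1 + M 0)) :=
      mul_le_mul (by linarith) b2 m2 (by positivity)
    have c2 : (1 + z) * (1 + M 0) ≤ (1 + z) ^ 3 * (1 + M 0) := by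
      refine mul_le_mul_of_nonneg_right ?_ (by positivity)
      nlinarith [sq_nonneg z, mul_nonneg hz (sq_nonneg z)]
    have c3 : M 3 ≤ (z + (1 + 2) * d) * M 2 + 2 * M 1 := by
      rw [e3]; norm_num
    linarith
  have c4 : z * M 2 ≤ (1 + z) * (3 * (1 + z) ^ 2 * (1 + M 0)) :=
    mul_le_mul (by linarith) b2 m2 (by positivity)
  linarith

/-- By Markov's inequality the mass M beyond 3 is at most (2M + 1)/3, and on (0, 3] the integrand is
at most e³. Cutting at 3 > 2 lets M be absorbed on the left. -/
theorem setIntegral_le_of_first_moment {f : ℝ → ℝ} (hz : z ≤ 1) (hf : ∀ s, 0 < s → 0 ≤ f s)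
    (hfz : ∀ s, 0 < s → f s ≤ Real.exp (z * s)) (i0 : IntegrableOn f (Set.Ioi 0))
    (i1 : IntegrableOn (fun s => s * f s) (Set.Ioi 0))
    (h : ∫ s in Set.Ioi (0 : ℝ), s * f s ≤ 2 * (∫ s in Set.Ioi (0 : ℝ), f s) + 1) :
    ∫ s in Set.Ioi (0 : ℝ), f s ≤ 9 * Real.exp 3 + 1 := by
  have hs : Set.Ioc (0 : ℝ) 3 ∪ Set.Ioi 3 = Set.Ioi 0 := Set.Ioc_union_Ioi_eq_Ioi (by norm_num)
  have j1 : IntegrableOn f (Set.Ioc 0 3) := i0.mono_set fun x hx => hx.1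
  have j2 : IntegrableOn f (Set.Ioi 3) := i0.mono_set (Set.Ioi_subset_Ioi (by norm_num))
  have j3 : IntegrableOn (fun s => s * f s) (Set.Ioi 3) :=
    i1.mono_set (Set.Ioi_subset_Ioi (by norm_num))
  have e : ∫ s in Set.Ioi (0 : ℝ), f s =
      (∫ s in Set.Ioc (0 : ℝ) 3, f s) + ∫ s in Set.Ioi (3 : ℝ), f s := by
    rw [← hs, setIntegral_union (Set.Ioc_disjoint_Ioi le_rfl) measurableSet_Ioi j1 j2]
  have b1 : ∫ s in Set.Ioc (0 : ℝ) 3, f s ≤ 3 * Real.exp 3 := by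
    have : ∫ s in Set.Ioc (0 : ℝ) 3, f s ≤ ∫ s in Set.Ioc (0 : ℝ) 3, Real.exp 3 := by
      refine setIntegral_mono_on j1 (integrableOn_const (by simp)) measurableSet_Ioc fun s hs => ?_
      refine (hfz s hs.1).trans (Real.exp_le_exp.2 ?_)
      nlinarith [hs.1, hs.2]
    simpa using this
  have b2 : ∫ s in Set.Ioi (3 : ℝ), f s ≤ 3⁻¹ * ∫ s in Set.Ioi (0 : ℝ), s * f s := by
    have c1 : ∫ s in Set.Ioi (3 : ℝ), f s ≤ ∫ s in Set.Ioi (3 : ℝ), 3⁻¹ * (s * f s) := by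
      refine setIntegral_mono_on j2 (j3.const_mul _) measurableSet_Ioi fun s hs => ?_
      have hs' : (3 : ℝ) < s := hs
      nlinarith [hf s (by linarith)]
    have c2 : ∫ s in Set.Ioi (3 : ℝ), s * f s ≤ ∫ s in Set.Ioi (0 : ℝ), s * f s := by
      refine setIntegral_mono_set i1 ?_ (Set.Ioi_subset_Ioi (by norm_num)).eventuallyLE
      refine (ae_restrict_iff' measurableSet_Ioi).2 (Eventually.of_forall fun s hs => ?_)
      have hs' : (0 : ℝ) < s := hs
      exact mul_nonneg hs'.le (hf s hs')
    rw [integral_const_mul] at c1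
    linarith
  linarith

/-- The interval (1/16, 1/8] alone suffices: its length is 1/16 and zs/2 ≥ z/32 there. -/
theorem le_setIntegral_of_exp_le {f : ℝ → ℝ} (hz : 0 ≤ z) (hf : ∀ s, 0 < s → 0 ≤ f s)
    (hfz : ∀ s, 0 < s → s ≤ 1 / 8 → Real.exp (z * s / 2) ≤ f s) (i0 : IntegrableOn f (Set.Ioi 0)) :
    Real.exp (z / 32) / 16 ≤ ∫ s in Set.Ioi (0 : ℝ), f s := by
  have hsub : Set.Ioc (1 / 16 : ℝ) (1 / 8) ⊆ Set.Ioi 0 := fun s hs =>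
    Set.mem_Ioi.2 (by linarith [hs.1])
  have c1 : ∫ s in Set.Ioc (1 / 16 : ℝ) (1 / 8), f s ≤ ∫ s in Set.Ioi (0 : ℝ), f s := by
    refine setIntegral_mono_set i0 ?_ hsub.eventuallyLE
    exact (ae_restrict_iff' measurableSet_Ioi).2 (Eventually.of_forall fun s hs => hf s hs)
  have c2 : ∫ s in Set.Ioc (1 / 16 : ℝ) (1 / 8), Real.exp (z / 32) ≤
      ∫ s in Set.Ioc (1 / 16 : ℝ) (1 / 8), f s := by
    refine setIntegral_mono_on (integrableOn_const (by simp)) (i0.mono_set hsub)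
      measurableSet_Ioc fun s hs => ?_
    refine le_trans (Real.exp_le_exp.2 ?_) (hfz s (hsub hs) hs.2)
    nlinarith [hs.1]
  refine le_trans (le_of_eq ?_) (c2.trans c1)
  simp
  norm_num
  ring

theorem abs_exp_sub_exp_le (a b : ℝ) :
    |Real.exp a - Real.exp b| ≤ |a - b| * (Real.exp a + Real.exp b) := by
  have key : ∀ a b : ℝ, b ≤ a →
      |Real.exp a - Real.exp b| ≤ |a - b| * (Real.exp a + Real.exp b) := by
    intro a b hab
    rw [abs_of_nonneg (sub_nonneg.2 (Real.exp_le_exp.2 hab)), abs_of_nonneg (sub_nonneg.2 hab)]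
    have h1 : Real.exp b = Real.exp a * Real.exp (b - a) := by
      rw [← Real.exp_add]; congr 1; ring
    have h2 := Real.add_one_le_exp (b - a)
    nlinarith [Real.exp_pos a, Real.exp_pos b, mul_le_mul_of_nonneg_left h2 (Real.exp_pos a).le,
      mul_nonneg (sub_nonneg.2 hab) (Real.exp_pos b).le]
  rcases le_total b a with h | h
  · exact key a b h
  · rw [abs_sub_comm, abs_sub_comm a b, add_comm]
    exact key b a h

/-- Logarithm of `(1 + s / r) ^ n * exp (-(r * s))`. -/
noncomputable def logGamma (n : ℕ) (r s : ℝ) : ℝ := n * Real.log (1 + s / r) - r * s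

theorem exp_logGamma (hr : 0 < r) {s : ℝ} (hs : 0 ≤ s) :
    Real.exp (logGamma n r s) = (1 + s / r) ^ n * Real.exp (-(r * s)) := by
  have : 0 < 1 + s / r := by positivity
  rw [logGamma, sub_eq_add_neg, Real.exp_add, mul_comm (n : ℝ), Real.exp_mul, Real.exp_log this,
    Real.rpow_natCast]

/-- The difference vanishes at 0 and its derivative is exactly -(z - t) t / (r + t), with z = `node
r n`; apply the mean value inequality. -/
theorem abs_logGamma_sub_le (hr : 0 < r) (hz : 0 ≤ node r n) {s : ℝ} (hs : 0 ≤ s) :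
    |logGamma n r s - (node r n * s - s ^ 2 / 2)| ≤ r⁻¹ * (s ^ 2 * (node r n + s)) := by
  have hd : ∀ t ∈ Set.Icc 0 s, HasDerivWithinAt
      (fun t => logGamma n r t - (node r n * t - t ^ 2 / 2))
      (-((node r n - t) * (t / r) / (1 + t / r))) (Set.Icc 0 s) t := by
    intro t ht
    have ht0 := ht.1
    have hpos : 0 < 1 + t / r := by positivity
    have h1 : HasDerivAt (fun t : ℝ => 1 + t / r) r⁻¹ t := by
      simpa using ((hasDerivAt_id t).div_const r).const_add 1
    refine HasDerivAt.hasDerivWithinAt ?_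
    refine ((((h1.log hpos.ne').const_mul (n : ℝ)).sub ((hasDerivAt_id t).const_mul r)).sub
      (((hasDerivAt_id t).const_mul (node r n)).sub
        ((hasDerivAt_pow 2 t).div_const 2))).congr_deriv ?_
    rw [cast_eq_node hr n]
    have : r + t ≠ 0 := by positivity
    field_simp
    ring
  have hb : ∀ t ∈ Set.Icc 0 s, ‖-((node r n - t) * (t / r) / (1 + t / r))‖ ≤
      r⁻¹ * (s * (node r n + s)) := by
    intro t ht
    have ht0 := ht.1
    have hpos : 1 ≤ 1 + t / r := le_add_of_nonneg_right (by positivity)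
    rw [norm_neg, Real.norm_eq_abs, abs_div, abs_mul, abs_of_nonneg (by positivity : 0 ≤ t / r),
      abs_of_nonneg (by positivity : 0 ≤ 1 + t / r)]
    refine (div_le_self (by positivity) hpos).trans ?_
    have h1 : |node r n - t| ≤ node r n + s := by
      rw [abs_le]; constructor <;> linarith [ht.2]
    calc |node r n - t| * (t / r) ≤ (node r n + s) * (s / r) :=
          mul_le_mul h1 (by gcongr; exact ht.2) (by positivity) (by positivity)
      _ = _ := by ring
  have := (convex_Icc 0 s).norm_image_sub_le_of_norm_hasDerivWithin_le hd hb
    (Set.left_mem_Icc.2 hs) (Set.right_mem_Icc.2 hs)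
  simp only [Real.norm_eq_abs, sub_zero, abs_of_nonneg hs] at this
  have h0 : logGamma n r 0 - (node r n * 0 - 0 ^ 2 / 2) = 0 := by simp [logGamma]
  rw [h0, sub_zero] at this
  refine this.trans_eq ?_
  ring

theorem abs_gammaMoment_sub_le (hr : 1 ≤ r) (hz : 0 ≤ node r n) :
    |gammaMoment n r 0 - gaussMoment (node r n) 0| ≤
      r⁻¹ * (14 * (1 + node r n) ^ 3 * (2 + gammaMoment n r 0 + gaussMoment (node r n) 0)) := by
  have hr0 : 0 < r := by linarith
  have b1 := third_moment_le (M := gammaMoment n r) hz (inv_le_one_of_one_le₀ hr)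
    (gammaMoment_nonneg hr0 n) (gammaMoment_one hr0) (gammaMoment_succ hr0)
  have b2 := third_moment_le (M := gaussMoment (node r n)) (d := 0) hz zero_le_one
    (gaussMoment_nonneg _) (by rw [gaussMoment_one, add_zero])
    (fun k => by rw [gaussMoment_succ, mul_zero, add_zero])
  have i := fun k => integrableOn_gammaMoment hr0 n k
  have j := fun k => integrableOn_gaussMoment (node r n) k
  have hle : |gammaMoment n r 0 - gaussMoment (node r n) 0| ≤
      ∫ s in Set.Ioi (0 : ℝ), r⁻¹ *
        ((node r n * (s ^ 2 * ((1 + s / r) ^ n * Real.exp (-(r * s)))) +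
          s ^ 3 * ((1 + s / r) ^ n * Real.exp (-(r * s)))) +
        (node r n * (s ^ 2 * Real.exp (node r n * s - s ^ 2 / 2)) +
          s ^ 3 * Real.exp (node r n * s - s ^ 2 / 2))) := by
    unfold gammaMoment gaussMoment
    rw [← integral_sub (i 0) (j 0), ← Real.norm_eq_abs]
    refine norm_integral_le_of_norm_le (((((i 2).const_mul _).add (i 3)).add
      (((j 2).const_mul _).add (j 3))).const_mul _) ?_
    refine (ae_restrict_iff' measurableSet_Ioi).2 (Eventually.of_forall fun s hs => ?_)
    have hs' : (0 : ℝ) ≤ s := le_of_lt hs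
    rw [← exp_logGamma hr0 hs', pow_zero, one_mul, one_mul, Real.norm_eq_abs]
    refine (abs_exp_sub_exp_le _ _).trans ((mul_le_mul_of_nonneg_right
      (abs_logGamma_sub_le hr0 hz hs') (by positivity)).trans_eq ?_)
    ring
  have h1 : IntegrableOn (fun s => node r n * (s ^ 2 * ((1 + s / r) ^ n * Real.exp (-(r * s)))) +
      s ^ 3 * ((1 + s / r) ^ n * Real.exp (-(r * s)))) (Set.Ioi 0) :=
    ((i 2).const_mul (node r n)).add (i 3)
  have h2 : IntegrableOn (fun s => node r n * (s ^ 2 * Real.exp (node r n * s - s ^ 2 / 2)) +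
      s ^ 3 * Real.exp (node r n * s - s ^ 2 / 2)) (Set.Ioi 0) :=
    ((j 2).const_mul (node r n)).add (j 3)
  rw [integral_const_mul, integral_add h1 h2, integral_add ((i 2).const_mul _) (i 3), integral_add ((j 2).const_mul _) (j 3),
    integral_const_mul, integral_const_mul] at hle
  refine hle.trans (mul_le_mul_of_nonneg_left ?_ (inv_nonneg.2 hr0.le))
  simp only [gammaMoment, gaussMoment] at b1 b2 ⊢
  linarith

theorem gammaMoment_zero_le (hr : 1 ≤ r) (hz1 : node r n ≤ 1) :
    gammaMoment n r 0 ≤ 9 * Real.exp 3 + 1 := by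
  have hr0 : 0 < r := by linarith
  have i0 := integrableOn_gammaMoment hr0 n 0
  have i1 := integrableOn_gammaMoment hr0 n 1
  have e1 := gammaMoment_one (n := n) hr0
  have m0 := gammaMoment_nonneg hr0 n 0
  have hb : gammaMoment n r 1 ≤ 2 * gammaMoment n r 0 + 1 := by
    have : node r n + r⁻¹ ≤ 2 := by linarith [inv_le_one_of_one_le₀ hr]
    nlinarith
  unfold gammaMoment at hb ⊢
  simp only [pow_zero, one_mul, pow_one] at i0 i1 hb ⊢
  refine setIntegral_le_of_first_moment hz1 (fun s hs => by positivity) (fun s hs => ?_) i0 i1 hb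
  have h1 : (1 + s / r) ^ n ≤ Real.exp (n * (s / r)) := by
    rw [Real.exp_nat_mul]
    refine pow_le_pow_left₀ (by positivity) ?_ n
    rw [add_comm]
    exact Real.add_one_le_exp _
  calc (1 + s / r) ^ n * Real.exp (-(r * s)) ≤ Real.exp (n * (s / r)) * Real.exp (-(r * s)) :=
        mul_le_mul_of_nonneg_right h1 (Real.exp_pos _).le
    _ = Real.exp (node r n * s) := by
        rw [← Real.exp_add, cast_eq_node hr0 n]
        congr 1
        field_simp
        ring

theorem gaussMoment_zero_le (hz1 : z ≤ 1) :
    gaussMoment z 0 ≤ 9 * Real.exp 3 + 1 := by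
  have i0 := integrableOn_gaussMoment z 0
  have i1 := integrableOn_gaussMoment z 1
  have m0 := gaussMoment_nonneg z 0
  have hb : gaussMoment z 1 ≤ 2 * gaussMoment z 0 + 1 := by
    rw [gaussMoment_one]
    nlinarith
  unfold gaussMoment at hb ⊢
  simp only [pow_zero, one_mul, pow_one] at i0 i1 hb ⊢
  refine setIntegral_le_of_first_moment hz1 (fun s hs => by positivity) (fun s hs => ?_) i0 i1 hb
  exact Real.exp_le_exp.2 (by nlinarith [sq_nonneg s])

/-- For s ≤ 1/8 and z ≥ 1, the terms s²/2 and s²(z + s) are at most zs/16 and 9zs/64, so the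
exponent keeps at least zs/2. -/
theorem le_gammaMoment_zero (hr : 1 ≤ r) (hz : 1 ≤ node r n) :
    Real.exp (node r n / 32) / 16 ≤ gammaMoment n r 0 := by
  have hr0 : 0 < r := by linarith
  have i0 := integrableOn_gammaMoment hr0 n 0
  unfold gammaMoment
  simp only [pow_zero, one_mul] at i0 ⊢
  refine le_setIntegral_of_exp_le (by linarith) (fun s hs => by positivity) (fun s hs hs8 => ?_) i0
  rw [← exp_logGamma hr0 hs.le]
  refine Real.exp_le_exp.2 ?_
  have h1 := (abs_le.1 (abs_logGamma_sub_le (n := n) hr0 (by linarith) hs.le)).1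
  have h2 : r⁻¹ * (s ^ 2 * (node r n + s)) ≤ 1 * (s ^ 2 * (node r n + s)) :=
    mul_le_mul_of_nonneg_right (inv_le_one_of_one_le₀ hr) (by positivity)
  have h3 : s ^ 2 * (node r n + s) ≤ s * (1 / 8) * (node r n + node r n * (1 / 8)) := by
    rw [sq]
    refine mul_le_mul (mul_le_mul_of_nonneg_left hs8 hs.le) ?_ (by positivity) (by positivity)
    nlinarith
  have h4 : s ^ 2 ≤ s * (1 / 8) * node r n := by
    have : s ^ 2 ≤ s * (1 / 8) := by nlinarith
    nlinarith
  nlinarith [mul_pos hs (by linarith : 0 < node r n)]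

theorem le_gaussMoment_zero (hz : 1 ≤ z) : Real.exp (z / 32) / 16 ≤ gaussMoment z 0 := by
  have i0 := integrableOn_gaussMoment z 0
  unfold gaussMoment
  simp only [pow_zero, one_mul] at i0 ⊢
  refine le_setIntegral_of_exp_le (by linarith) (fun s hs => by positivity) (fun s hs hs8 => ?_) i0
  refine Real.exp_le_exp.2 ?_
  nlinarith [mul_pos hs (by linarith : 0 < z)]

theorem pow_mul_div_exp_le (hz : 0 ≤ z) (k : ℕ) :
    z ^ k * (1 + Real.exp (z / 32) / 16)⁻¹ ≤ 16 * 32 ^ k * k.factorial := by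
  have h := Real.pow_div_factorial_le_exp (z / 32) (by positivity) k
  have hk : (0 : ℝ) < k.factorial := by exact_mod_cast k.factorial_pos
  rw [div_le_iff₀ hk, div_pow, div_le_iff₀ (by positivity)] at h
  rw [← div_eq_mul_inv, div_le_iff₀ (by positivity)]
  have : (0 : ℝ) < 16 * 32 ^ k * k.factorial := by positivity
  nlinarith

/-- Comparison of the delay probabilities `1 / (1 + z * M)` of the two systems. -/
theorem delay_bounds (hr : 1 ≤ r) (hz : 0 < node r n) (k : ℕ) :
    (1 + node r n * gammaMoment n r 0)⁻¹ * node r n ^ k ≤ 1 + 16 * 32 ^ k * k.factorial ∧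
    max 1 (node r n)⁻¹ * |(1 + node r n * gammaMoment n r 0)⁻¹ -
      (1 + node r n * gaussMoment (node r n) 0)⁻¹| * node r n ^ k ≤
      (112 * (4 + 18 * Real.exp 3) + 224 * (16 * 32 ^ (k + 4) * (k + 4).factorial)) * r⁻¹ := by
  have hr0 : 0 < r := by linarith
  have hg := gammaMoment_nonneg hr0 n 0
  have hG := gaussMoment_nonneg (node r n) 0
  have hD := abs_gammaMoment_sub_le hr hz.le
  have hub := gammaMoment_zero_le (n := n) hr
  have hUb := gaussMoment_zero_le (z := node r n)
  have hlb := le_gammaMoment_zero (n := n) hr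
  have hLb := le_gaussMoment_zero (z := node r n)
  have hexp := pow_mul_div_exp_le hz.le
  generalize gammaMoment n r 0 = g at *
  generalize gaussMoment (node r n) 0 = G at *
  generalize node r n = z at *
  have hδ : 0 ≤ r⁻¹ := inv_nonneg.2 hr0.le
  -- The factor z here is the spare one: it cancels 1/z when z ≤ 1.
  have hdiff : |(1 + z * g)⁻¹ - (1 + z * G)⁻¹| =
      z * |g - G| * ((1 + z * g)⁻¹ * (1 + z * G)⁻¹) := by
    have h1 : (1 + z * g) ≠ 0 := by positivity
    have h2 : (1 + z * G) ≠ 0 := by positivity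
    have : (1 + z * g)⁻¹ - (1 + z * G)⁻¹ = -(z * (g - G)) * ((1 + z * g)⁻¹ * (1 + z * G)⁻¹) := by
      field_simp
      ring
    rw [this, abs_mul, abs_neg, abs_mul, abs_of_pos hz,
      abs_of_nonneg (by positivity : 0 ≤ (1 + z * g)⁻¹ * (1 + z * G)⁻¹)]
  have hp1 : (1 + z * g)⁻¹ ≤ 1 := inv_le_one_of_one_le₀ (le_add_of_nonneg_right (by positivity))
  have hq1 : (1 + z * G)⁻¹ ≤ 1 := inv_le_one_of_one_le₀ (le_add_of_nonneg_right (by positivity))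
  have hp0 : 0 ≤ (1 + z * g)⁻¹ := by positivity
  have hq0 : 0 ≤ (1 + z * G)⁻¹ := by positivity
  rcases le_total z 1 with h1 | h1
  · have hzk : z ^ k ≤ 1 := pow_le_one₀ hz.le h1
    constructor
    · calc (1 + z * g)⁻¹ * z ^ k ≤ 1 * 1 := mul_le_mul hp1 hzk (by positivity) zero_le_one
        _ ≤ _ := by
          have : (0 : ℝ) ≤ 16 * 32 ^ k * k.factorial := by positivity
          linarith
    · rw [max_eq_right ((one_le_inv₀ hz).2 h1), hdiff]
      have e1 : z⁻¹ * (z * |g - G| * ((1 + z * g)⁻¹ * (1 + z * G)⁻¹)) * z ^ k =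
          |g - G| * ((1 + z * g)⁻¹ * (1 + z * G)⁻¹ * z ^ k) := by
        field_simp
      have e2 : (1 + z * g)⁻¹ * (1 + z * G)⁻¹ * z ^ k ≤ 1 :=
        mul_le_one₀ (mul_le_one₀ hp1 hq0 hq1) (by positivity) hzk
      rw [e1]
      calc |g - G| * ((1 + z * g)⁻¹ * (1 + z * G)⁻¹ * z ^ k) ≤ |g - G| * 1 :=
            mul_le_mul_of_nonneg_left e2 (abs_nonneg _)
        _ ≤ r⁻¹ * (14 * (1 + z) ^ 3 * (2 + g + G)) := by rw [mul_one]; exact hD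
        _ ≤ r⁻¹ * (14 * (1 + 1) ^ 3 * (2 + (9 * Real.exp 3 + 1) + (9 * Real.exp 3 + 1))) := by
            gcongr
            · exact hub h1
            · exact hUb h1
        _ ≤ _ := by
            rw [mul_comm]
            refine mul_le_mul_of_nonneg_right ?_ hδ
            have : (0 : ℝ) ≤ 16 * 32 ^ (k + 4) * (k + 4).factorial := by positivity
            linarith
  · have hpL : (1 + z * g)⁻¹ ≤ (1 + g)⁻¹ := by
      refine inv_anti₀ (by positivity) ?_
      nlinarith
    have hqL : (1 + z * G)⁻¹ ≤ (1 + G)⁻¹ := by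
      refine inv_anti₀ (by positivity) ?_
      nlinarith
    have hgL : (1 + g)⁻¹ ≤ (1 + Real.exp (z / 32) / 16)⁻¹ :=
      inv_anti₀ (by positivity) (by linarith [hlb h1])
    have hGL : (1 + G)⁻¹ ≤ (1 + Real.exp (z / 32) / 16)⁻¹ :=
      inv_anti₀ (by positivity) (by linarith [hLb h1])
    constructor
    · calc (1 + z * g)⁻¹ * z ^ k ≤ (1 + Real.exp (z / 32) / 16)⁻¹ * z ^ k :=
            mul_le_mul_of_nonneg_right (hpL.trans hgL) (by positivity)
        _ ≤ _ := by
          rw [mul_comm]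
          linarith [hexp k]
    · rw [max_eq_left (inv_le_one_of_one_le₀ h1), hdiff, one_mul]
      -- The growth of |g - G| in g and G is cancelled by the two denominators, and one
      -- exponentially small factor remains to absorb z^(k + 4).
      have e1 : (2 + g + G) * ((1 + z * g)⁻¹ * (1 + z * G)⁻¹) ≤
          2 * (1 + Real.exp (z / 32) / 16)⁻¹ := by
        calc (2 + g + G) * ((1 + z * g)⁻¹ * (1 + z * G)⁻¹) ≤
            (2 + g + G) * ((1 + g)⁻¹ * (1 + G)⁻¹) := by gcongr
          _ = (1 + G)⁻¹ + (1 + g)⁻¹ := by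
            field_simp
            ring
          _ ≤ _ := by linarith
      calc z * |g - G| * ((1 + z * g)⁻¹ * (1 + z * G)⁻¹) * z ^ k
          ≤ z * (r⁻¹ * (14 * (z + z) ^ 3 * (2 + g + G))) *
            ((1 + z * g)⁻¹ * (1 + z * G)⁻¹) * z ^ k := by
            refine mul_le_mul_of_nonneg_right (mul_le_mul_of_nonneg_right
              (mul_le_mul_of_nonneg_left (hD.trans ?_) hz.le) (by positivity)) (by positivity)
            gcongr
        _ = 112 * r⁻¹ * z ^ (k + 4) * ((2 + g + G) * ((1 + z * g)⁻¹ * (1 + z * G)⁻¹)) := by ring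
        _ ≤ 112 * r⁻¹ * z ^ (k + 4) * (2 * (1 + Real.exp (z / 32) / 16)⁻¹) :=
            mul_le_mul_of_nonneg_left e1 (by positivity)
        _ = 224 * r⁻¹ * (z ^ (k + 4) * (1 + Real.exp (z / 32) / 16)⁻¹) := by ring
        _ ≤ 224 * r⁻¹ * (16 * 32 ^ (k + 4) * (k + 4).factorial) :=
            mul_le_mul_of_nonneg_left (hexp (k + 4)) (by positivity)
        _ ≤ _ := by
            have : 0 ≤ Real.exp 3 * r⁻¹ := by positivity
            linarith

end Comparison


/-! ### Induction on the moments with uniform constants. -/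

/-- Remainder constant in the moment recursions. -/
def remainderConst (k : ℕ) : ℝ := (k + 1) + k * (2 ^ (k + 1) * 2)

theorem remainderConst_nonneg (k : ℕ) : 0 ≤ remainderConst k := by
  unfold remainderConst
  positivity

theorem abs_sum_choose_le {d B : ℝ} (hd : 0 ≤ d) (hd1 : d ≤ 1) (k : ℕ) (f : ℕ → ℝ)
    (hf : ∀ j < k, d ^ 2 * |f j| ≤ B) :
    |∑ j ∈ Finset.range k, ((k + 1).choose j : ℝ) * (-d) ^ (k + 1 - j) * f j| ≤
      k * (2 ^ (k + 1) * B) := by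
  refine (Finset.abs_sum_le_sum_abs _ _).trans ?_
  have : ∑ j ∈ Finset.range k, (2 ^ (k + 1) * B) = k * (2 ^ (k + 1) * B) := by simp
  rw [← this]
  refine Finset.sum_le_sum fun j hj => ?_
  have hj' := Finset.mem_range.1 hj
  rw [abs_mul, abs_mul, abs_pow, abs_neg, abs_of_nonneg hd, Nat.abs_cast, mul_assoc]
  have h1 : ((k + 1).choose j : ℝ) ≤ 2 ^ (k + 1) := by
    exact_mod_cast Nat.choose_le_two_pow (k + 1) j
  have h2 : d ^ (k + 1 - j) ≤ d ^ 2 := pow_le_pow_of_le_one hd hd1 (by omega)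
  refine mul_le_mul h1 ?_ (by positivity) (by positivity)
  exact (mul_le_mul_of_nonneg_right h2 (abs_nonneg _)).trans (hf j hj')

/-- The terms j = k + 1 and j = k supply a (k + 2), (k + 1) a k and an O(1/r) remainder. All others
carry r⁻¹ to a power at least 2, which beats the factor r in r a j. -/
theorem lower_step {r P B : ℝ} {a : ℕ → ℝ} {k : ℕ} (hr : 1 ≤ r)
    (h : r * a (k + 1) - ∑ j ∈ Finset.range (k + 1 + 1), ((k + 1).choose j : ℝ) *
      (-r⁻¹) ^ (k + 1 - j) * (r * a j + a (j + 1)) = P)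
    (hB : ∀ j ≤ k + 1, |a j| ≤ B) :
    |a (k + 2) - ((k + 1) * a k - P)| ≤ r⁻¹ * (remainderConst k * B) := by
  have hr0 : 0 < r := by linarith
  have hd : 0 ≤ r⁻¹ := inv_nonneg.2 hr0.le
  have hd1 : r⁻¹ ≤ 1 := inv_le_one_of_one_le₀ hr
  rw [Finset.sum_range_succ, Finset.sum_range_succ] at h
  have hsum := abs_sum_choose_le (B := r⁻¹ * (2 * B)) hd hd1 k (fun j => r * a j + a (j + 1)) (by
    intro j hj
    have h1 : |r * a j + a (j + 1)| ≤ r * (2 * B) := by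
      refine (abs_add_le _ _).trans ?_
      rw [abs_mul, abs_of_pos hr0]
      nlinarith [hB j (by omega), hB (j + 1) (by omega), abs_nonneg (a (j + 1))]
    calc r⁻¹ ^ 2 * |r * a j + a (j + 1)| ≤ r⁻¹ ^ 2 * (r * (2 * B)) :=
          mul_le_mul_of_nonneg_left h1 (by positivity)
      _ = r⁻¹ * (2 * B) := by field_simp)
  simp only [show k + 1 - k = 1 by omega, Nat.sub_self, pow_one, pow_zero, Nat.choose_self,
    Nat.choose_succ_self_right, Nat.cast_one, mul_one, one_mul] at h
  have e : a (k + 2) - ((k + 1) * a k - P) = r⁻¹ * ((k + 1) * a (k + 1)) -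
      ∑ j ∈ Finset.range k, ((k + 1).choose j : ℝ) * (-r⁻¹) ^ (k + 1 - j) *
        (r * a j + a (j + 1)) := by
    have : r⁻¹ * (r * a k) = a k := by field_simp
    push_cast at h
    linear_combination (-1) * h + (k + 1) * this
  rw [e]
  refine (abs_sub _ _).trans ?_
  rw [abs_mul, abs_of_nonneg hd, abs_mul, abs_of_nonneg (by positivity : (0 : ℝ) ≤ k + 1)]
  have h2 : r⁻¹ * ((k + 1) * |a (k + 1)|) ≤ r⁻¹ * ((k + 1) * B) :=
    mul_le_mul_of_nonneg_left (mul_le_mul_of_nonneg_left (hB _ le_rfl) (by positivity)) hd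
  unfold remainderConst
  linarith

/-- Solving for b (k + 1) divides by z. In the terms j < k the coefficient r⁻² (r + z)/z is r⁻¹ (1/z
+ 1/r) ≤ 2 y r⁻¹, and the extra y fits because j + 1 ≤ k. -/
theorem upper_step {r z y P B : ℝ} {b : ℕ → ℝ} {k : ℕ} (hr : 1 ≤ r) (hz : 0 < z) (hy : 1 ≤ y)
    (hzy : z⁻¹ ≤ y)
    (h : r * b (k + 1) - (r + z) * ∑ j ∈ Finset.range (k + 1 + 1), ((k + 1).choose j : ℝ) *
      (-r⁻¹) ^ (k + 1 - j) * b j = -P)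
    (hB : ∀ j ≤ k, |b j| ≤ B * y ^ j) :
    |b (k + 1) - (P * z⁻¹ + (k + 1) * b k * z⁻¹)| ≤ r⁻¹ * (remainderConst k * B * y ^ k) := by
  have hr0 : 0 < r := by linarith
  have hd : 0 ≤ r⁻¹ := inv_nonneg.2 hr0.le
  have hd1 : r⁻¹ ≤ 1 := inv_le_one_of_one_le₀ hr
  have hB0 : 0 ≤ B := by simpa using (abs_nonneg _).trans (hB 0 (Nat.zero_le _))
  rw [Finset.sum_range_succ, Finset.sum_range_succ] at h
  have hsum := abs_sum_choose_le (B := r⁻¹ * (2 * (B * y ^ k))) hd hd1 k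
    (fun j => (r + z) * z⁻¹ * b j) (by
      intro j hj
      have e1 : r⁻¹ ^ 2 * ((r + z) * z⁻¹) = r⁻¹ * (z⁻¹ + r⁻¹) := by
        field_simp
      have h2 : y * |b j| ≤ B * y ^ k := by
        calc y * |b j| ≤ y * (B * y ^ j) :=
              mul_le_mul_of_nonneg_left (hB j hj.le) (by linarith)
          _ = B * y ^ (j + 1) := by ring
          _ ≤ B * y ^ k := mul_le_mul_of_nonneg_left (pow_le_pow_right₀ hy hj) hB0
      rw [abs_mul, abs_of_nonneg (by positivity), ← mul_assoc, e1, mul_assoc]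
      refine mul_le_mul_of_nonneg_left ?_ hd
      nlinarith [abs_nonneg (b j)])
  simp only [show k + 1 - k = 1 by omega, Nat.sub_self, pow_one, pow_zero, Nat.choose_self,
    Nat.choose_succ_self_right, Nat.cast_one, one_mul] at h
  have e : b (k + 1) - (P * z⁻¹ + (k + 1) * b k * z⁻¹) = r⁻¹ * ((k + 1) * b k) -
      ∑ j ∈ Finset.range k, ((k + 1).choose j : ℝ) * (-r⁻¹) ^ (k + 1 - j) *
        ((r + z) * z⁻¹ * b j) := by
    have e2 : ∑ j ∈ Finset.range k, ((k + 1).choose j : ℝ) * (-r⁻¹) ^ (k + 1 - j) *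
        ((r + z) * z⁻¹ * b j) = (r + z) * z⁻¹ *
        ∑ j ∈ Finset.range k, ((k + 1).choose j : ℝ) * (-r⁻¹) ^ (k + 1 - j) * b j := by
      rw [Finset.mul_sum]
      exact Finset.sum_congr rfl fun j _ => by ring
    rw [e2]
    push_cast at h
    field_simp at h ⊢
    linear_combination (-1) * h
  rw [e]
  refine (abs_sub _ _).trans ?_
  rw [abs_mul, abs_of_nonneg hd, abs_mul, abs_of_nonneg (by positivity : (0 : ℝ) ≤ k + 1)]
  have h2 : r⁻¹ * ((k + 1) * |b k|) ≤ r⁻¹ * ((k + 1) * (B * y ^ k)) :=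
    mul_le_mul_of_nonneg_left (mul_le_mul_of_nonneg_left (hB _ le_rfl) (by positivity)) hd
  unfold remainderConst
  linarith

/-- There is no division by z here, so the errors stay of order 1/r without any y. The bounds on P
zʲ and (P - q) zʲ control the boundary terms uniformly in z. -/
theorem exists_lower_bound (c : ℕ → ℝ) (hc : ∀ j, 0 ≤ c j) (k : ℕ) :
    ∃ C : ℝ, 0 ≤ C ∧ ∀ (r z P q : ℝ) (a α : ℕ → ℝ), 1 ≤ r → |a 0| ≤ 1 → |a 0 - α 0| ≤ c 0 * r⁻¹ →
      (∀ j, |P * z ^ j| ≤ c j) → (∀ j, |P * z ^ j - q * z ^ j| ≤ c j * r⁻¹) →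
      (∀ k, r * a k - ∑ j ∈ Finset.range (k + 1), (k.choose j : ℝ) *
        (-r⁻¹) ^ (k - j) * (r * a j + a (j + 1)) = P * z ^ (k + 1)) →
      α 1 = -(q * z) → (∀ k : ℕ, α (k + 2) = (k + 1) * α k - q * z ^ (k + 2)) →
      ∀ j ≤ k + 1, |a j| ≤ C ∧ |a j - α j| ≤ C * r⁻¹ := by
  induction k with
  | zero =>
    refine ⟨1 + c 0 + c 1, by linarith [hc 0, hc 1], ?_⟩
    intro r z P q a α hr ha0 hα0 hP hPq hrec hα1 _ j hj
    have hd : 0 ≤ r⁻¹ := inv_nonneg.2 (by linarith)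
    interval_cases j
    · exact ⟨by linarith [hc 0, hc 1], hα0.trans
        (mul_le_mul_of_nonneg_right (by linarith [hc 1]) hd)⟩
    · have h1 : a 1 = -(P * z) := by
        have := hrec 0
        simp at this
        linarith
      have h2 := hP 1
      have h3 := hPq 1
      rw [pow_one] at h2 h3
      rw [h1, hα1, abs_neg]
      refine ⟨by linarith [hc 0, hc 1], ?_⟩
      rw [show -(P * z) - -(q * z) = -(P * z - q * z) by ring, abs_neg]
      exact h3.trans (mul_le_mul_of_nonneg_right (by linarith [hc 0]) hd)
  | succ k ih =>
    obtain ⟨C, hC, ih⟩ := ih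
    have hK := remainderConst_nonneg k
    refine ⟨C + ((k + 1) * C + c (k + 2) + remainderConst k * C),
      by have := hc (k + 2); positivity, ?_⟩
    intro r z P q a α hr ha0 hα0 hP hPq hrec hα1 hα j hj
    have hd : 0 ≤ r⁻¹ := inv_nonneg.2 (by linarith)
    have hd1 : r⁻¹ ≤ 1 := inv_le_one_of_one_le₀ hr
    have ih := ih r z P q a α hr ha0 hα0 hP hPq hrec hα1 hα
    have hc2 := hc (k + 2)
    have hKC : 0 ≤ remainderConst k * C := mul_nonneg hK hC
    have hk : (0 : ℝ) ≤ (k + 1) * C := by positivity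
    rcases Nat.lt_or_ge j (k + 2) with hj' | hj'
    · obtain ⟨h1, h2⟩ := ih j (by omega)
      exact ⟨by linarith, h2.trans (mul_le_mul_of_nonneg_right (by linarith) hd)⟩
    · obtain rfl : j = k + 2 := by omega
      have hs := lower_step hr (hrec (k + 1)) fun j hj => (ih j hj).1
      obtain ⟨h1, h2⟩ := ih k (by omega)
      have h1' : |((k : ℝ) + 1) * a k| ≤ (k + 1) * C := by
        rw [abs_mul, abs_of_nonneg (by positivity : (0 : ℝ) ≤ k + 1)]
        exact mul_le_mul_of_nonneg_left h1 (by positivity)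
      have h2' : |((k : ℝ) + 1) * (a k - α k)| ≤ (k + 1) * (C * r⁻¹) := by
        rw [abs_mul, abs_of_nonneg (by positivity : (0 : ℝ) ≤ k + 1)]
        exact mul_le_mul_of_nonneg_left h2 (by positivity)
      have h3 := hP (k + 2)
      have h4 := hPq (k + 2)
      have hs' : r⁻¹ * (remainderConst k * C) ≤ remainderConst k * C :=
        mul_le_of_le_one_left hKC hd1
      rw [show k + 1 + 1 = k + 2 by ring] at hs
      constructor
      · have hs2 := hs.trans hs'
        rw [abs_le] at *
        constructor <;> linarith
      · rw [hα k]
        rw [abs_le] at *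
        constructor <;> nlinarith

/-- The induction carries the difference multiplied by y. The initial error P - q tolerates this
factor, each step costs one further y, and dividing by y at the end saves a power. -/
theorem exists_upper_bound (c : ℕ → ℝ) (hc : ∀ j, 0 ≤ c j) (k : ℕ) :
    ∃ C : ℝ, 0 ≤ C ∧ ∀ (r z y P q : ℝ) (b β : ℕ → ℝ), 1 ≤ r → 0 < z → 1 ≤ y → z⁻¹ ≤ y →
      b 0 = P → β 0 = q →
      (∀ j, |P * z ^ j| ≤ c j) → (∀ j, y * |P * z ^ j - q * z ^ j| ≤ c j * r⁻¹) →
      (∀ k, r * b k - (r + z) * ∑ j ∈ Finset.range (k + 1), (k.choose j : ℝ) *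
        (-r⁻¹) ^ (k - j) * b j = -(P * z ^ (k + 1))) →
      (∀ k : ℕ, β (k + 1) = q * z ^ (k + 1) + (k + 1) * β k * z⁻¹) →
      ∀ j ≤ k, |b j| ≤ C * y ^ j ∧ y * |b j - β j| ≤ C * r⁻¹ * y ^ j := by
  induction k with
  | zero =>
    refine ⟨c 0, hc 0, ?_⟩
    intro r z y P q b β hr hz hy hzy hb0 hβ0 hP hPq hrec hβ j hj
    obtain rfl : j = 0 := by omega
    simpa [hb0, hβ0] using And.intro (hP 0) (hPq 0)
  | succ k ih =>
    obtain ⟨C, hC, ih⟩ := ih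
    have hK := remainderConst_nonneg k
    refine ⟨C + ((k + 1) * C + c (k + 1) + remainderConst k * C),
      by have := hc (k + 1); positivity, ?_⟩
    intro r z y P q b β hr hz hy hzy hb0 hβ0 hP hPq hrec hβ j hj
    have hd : 0 ≤ r⁻¹ := inv_nonneg.2 (by linarith)
    have hd1 : r⁻¹ ≤ 1 := inv_le_one_of_one_le₀ hr
    have ih := ih r z y P q b β hr hz hy hzy hb0 hβ0 hP hPq hrec hβ
    have hc2 := hc (k + 1)
    have hKC : 0 ≤ remainderConst k * C := mul_nonneg hK hC
    have hk : (0 : ℝ) ≤ (k + 1) * C := by positivity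
    have hy0 : 0 ≤ y := by linarith
    rcases Nat.lt_or_ge j (k + 1) with hj' | hj'
    · obtain ⟨h1, h2⟩ := ih j (by omega)
      have hyj : 0 ≤ y ^ j := by positivity
      exact ⟨h1.trans (mul_le_mul_of_nonneg_right (by linarith) hyj), h2.trans
        (mul_le_mul_of_nonneg_right (mul_le_mul_of_nonneg_right (by linarith) hd) hyj)⟩
    · obtain rfl : j = k + 1 := by omega
      have hs := upper_step hr hz hy hzy (hrec (k + 1)) fun j hj => (ih j hj).1
      obtain ⟨h1, h2⟩ := ih k le_rfl
      have hzi : 0 ≤ z⁻¹ := inv_nonneg.2 hz.le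
      have hyk : y ^ k ≤ y ^ (k + 1) := pow_le_pow_right₀ hy (by omega)
      have hyk1 : 1 ≤ y ^ (k + 1) := one_le_pow₀ hy
      have hyk0 : 0 ≤ y ^ k := by positivity
      have e1 : P * z ^ (k + 1 + 1) * z⁻¹ = P * z ^ (k + 1) := by
        field_simp
        ring
      rw [e1] at hs
      have h3 := hP (k + 1)
      have h4 := hPq (k + 1)
      have g1 : |((k : ℝ) + 1) * b k * z⁻¹| ≤ (k + 1) * C * y ^ (k + 1) := by
        rw [abs_mul, abs_mul, abs_of_nonneg (by positivity : (0 : ℝ) ≤ k + 1), abs_of_nonneg hzi]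
        calc ((k : ℝ) + 1) * |b k| * z⁻¹ ≤ (k + 1) * (C * y ^ k) * y := by gcongr
          _ = _ := by ring
      have g2 : y * |((k : ℝ) + 1) * (b k - β k) * z⁻¹| ≤ (k + 1) * C * r⁻¹ * y ^ (k + 1) := by
        rw [abs_mul, abs_mul, abs_of_nonneg (by positivity : (0 : ℝ) ≤ k + 1), abs_of_nonneg hzi]
        calc y * (((k : ℝ) + 1) * |b k - β k| * z⁻¹) = (k + 1) * (y * |b k - β k|) * z⁻¹ := by ring
          _ ≤ (k + 1) * (C * r⁻¹ * y ^ k) * y := by gcongr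
          _ = _ := by ring
      have g3 : c (k + 1) ≤ c (k + 1) * y ^ (k + 1) := le_mul_of_one_le_right hc2 hyk1
      have g4 : r⁻¹ * (remainderConst k * C * y ^ k) ≤ remainderConst k * C * y ^ (k + 1) :=
        (mul_le_of_le_one_left (by positivity) hd1).trans (mul_le_mul_of_nonneg_left hyk hKC)
      have g5 : 0 ≤ C * y ^ (k + 1) := by positivity
      constructor
      · have t := abs_add_three (b (k + 1) - (P * z ^ (k + 1) + (k + 1) * b k * z⁻¹))
          (P * z ^ (k + 1)) ((k + 1) * b k * z⁻¹)
        rw [show b (k + 1) - (P * z ^ (k + 1) + (k + 1) * b k * z⁻¹) + P * z ^ (k + 1) +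
          (k + 1) * b k * z⁻¹ = b (k + 1) by ring] at t
        linarith
      · have t := mul_le_mul_of_nonneg_left
          (abs_add_three (b (k + 1) - (P * z ^ (k + 1) + (k + 1) * b k * z⁻¹))
            (P * z ^ (k + 1) - q * z ^ (k + 1)) ((k + 1) * (b k - β k) * z⁻¹)) hy0
        rw [show b (k + 1) - (P * z ^ (k + 1) + (k + 1) * b k * z⁻¹) +
          (P * z ^ (k + 1) - q * z ^ (k + 1)) + (k + 1) * (b k - β k) * z⁻¹ =
          b (k + 1) - β (k + 1) by rw [hβ k]; ring] at t
        have g6 : y * |b (k + 1) - (P * z ^ (k + 1) + (k + 1) * b k * z⁻¹)| ≤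
            remainderConst k * C * r⁻¹ * y ^ (k + 1) :=
          (mul_le_mul_of_nonneg_left hs hy0).trans_eq (by ring)
        have g7 : c (k + 1) * r⁻¹ ≤ c (k + 1) * r⁻¹ * y ^ (k + 1) :=
          le_mul_of_one_le_right (by positivity) hyk1
        have g8 : 0 ≤ C * r⁻¹ * y ^ (k + 1) := by positivity
        linarith


/-- Bounds for the delay probability and its approximation error, weighted by `z ^ k`. -/
noncomputable def delayConst (k : ℕ) : ℝ := (1 + 16 * 32 ^ k * k.factorial) +
  (112 * (4 + 18 * Real.exp 3) + 224 * (16 * 32 ^ (k + 4) * (k + 4).factorial))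

theorem delayConst_nonneg (k : ℕ) : 0 ≤ delayConst k := by
  unfold delayConst
  positivity

theorem exists_moment_bound (m : ℕ) :
    ∃ C : ℝ, ∀ (n : ℕ) (r : ℝ) (p : ℕ → ℝ), 1 ≤ r → r ^ 2 < n → Balanced n r p →
      lowerMoment n r p 0 + upperMoment n r p 0 = 1 →
      |(lowerMoment n r p (m + 1) + upperMoment n r p (m + 1)) -
        (gaussPart (node r n) 0 + expPart (node r n) 0)⁻¹ *
          (gaussPart (node r n) (m + 1) + expPart (node r n) (m + 1))| ≤
        (1 + 1 / node r n ^ m) * C * r⁻¹ := by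
  obtain ⟨C₁, hC₁, h₁⟩ := exists_lower_bound delayConst delayConst_nonneg m
  obtain ⟨C₂, hC₂, h₂⟩ := exists_upper_bound delayConst delayConst_nonneg (m + 1)
  refine ⟨C₁ + C₂, ?_⟩
  intro n r p hr hn hp hone
  have hr0 : 0 < r := by linarith
  have hd : 0 ≤ r⁻¹ := inv_nonneg.2 hr0.le
  have hz : 0 < node r n := div_pos (by linarith) hr0
  have hg := gammaMoment_nonneg hr0 n 0
  have hG := gaussMoment_nonneg (node r n) 0
  have hdel := delay_bounds hr hz
  have ha0 := hp.lowerMoment_zero hr0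
  have hlow := hp.lowerMoment_rec hr0
  have hup := hp.upperMoment_rec hr0 hn
  have hv0 := mul_expPart_zero hz
  have hv := mul_expPart_succ hz
  have hZ := gaussPart_add_expPart_pos hz
  have hu0 := gaussPart_zero (node r n)
  have hu1 := gaussPart_one (node r n)
  have hu := gaussPart_succ (node r n)
  generalize gammaMoment n r 0 = g at *
  generalize gaussMoment (node r n) 0 = G at *
  generalize hzdef : node r n = z at *
  generalize lowerMoment n r p = a at *
  generalize upperMoment n r p = b at *
  generalize gaussPart z = u at *
  generalize expPart z = v at *
  -- The upper recursion at k = 0, which expresses the boundary mass through the tail mass; with a 0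
  -- + b 0 = 1 it determines b 0.
  have hPn : r * p n = b 0 * z := by
    have := hup 0
    simp at this
    linarith
  have hP : b 0 = (1 + z * g)⁻¹ := by
    refine eq_inv_of_mul_eq_one_left ?_
    rw [ha0, hPn] at hone
    linarith
  have hq : (u 0 + v 0)⁻¹ * v 0 = (1 + z * G)⁻¹ := by
    have e : u 0 + v 0 = v 0 * (1 + z * G) := by rw [hu0, ← hv0]; ring
    have hv00 : v 0 ≠ 0 := by
      intro h0
      rw [e, h0, zero_mul] at hZ
      exact lt_irrefl _ hZ
    rw [e, mul_inv, mul_right_comm, inv_mul_cancel₀ hv00, one_mul]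
  set κ := (u 0 + v 0)⁻¹ with hκ
  have hκ1 : κ * (u 0 + v 0) = 1 := inv_mul_cancel₀ hZ.ne'
  set y := max 1 z⁻¹ with hy
  have hy1 : 1 ≤ y := le_max_left _ _
  have hzy : z⁻¹ ≤ y := le_max_right _ _
  have hP0 : 0 ≤ b 0 := by rw [hP]; positivity
  rw [← hP, ← hq] at hdel
  have hPc : ∀ j, |b 0 * z ^ j| ≤ delayConst j := by
    intro j
    rw [abs_of_nonneg (by positivity)]
    refine (hdel j).1.trans ?_
    unfold delayConst
    have : 0 ≤ 112 * (4 + 18 * Real.exp 3) +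
      224 * (16 * 32 ^ (j + 4) * ((j + 4).factorial : ℝ)) := by positivity
    linarith
  have hPq : ∀ j, y * |b 0 * z ^ j - κ * v 0 * z ^ j| ≤ delayConst j * r⁻¹ := by
    intro j
    rw [← sub_mul, abs_mul, abs_of_nonneg (by positivity : 0 ≤ z ^ j), ← mul_assoc]
    refine (hdel j).2.trans (mul_le_mul_of_nonneg_right ?_ hd)
    unfold delayConst
    have : (0 : ℝ) ≤ 1 + 16 * 32 ^ j * j.factorial := by positivity
    linarith
  have hPq' : ∀ j, |b 0 * z ^ j - κ * v 0 * z ^ j| ≤ delayConst j * r⁻¹ := fun j =>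
    (le_mul_of_one_le_left (abs_nonneg _) hy1).trans (hPq j)
  have hA := (h₁ r z (b 0) (κ * v 0) a (fun k => κ * u k) hr
    (by
      have : 0 ≤ a 0 := by rw [ha0, hPn]; positivity
      rw [abs_of_nonneg this]
      linarith)
    (by
      have e : a 0 - κ * u 0 = -(b 0 * z ^ 0 - κ * v 0 * z ^ 0) := by
        rw [pow_zero]
        linear_combination hone - hκ1
      rw [e, abs_neg]
      exact hPq' 0)
    hPc hPq'
    (fun k => by rw [hlow k, hPn, pow_succ]; ring)
    (by rw [hu1, ← hv0]; ring)
    (fun k => by rw [hu k, ← hv0]; ring) (m + 1) le_rfl).2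
  have hB := (h₂ r z y (b 0) (κ * v 0) b (fun k => κ * v k) hr hz hy1 hzy rfl rfl hPc hPq
    (fun k => by rw [hup k, hPn, pow_succ]; ring)
    (fun k => by
      have := hv k
      rw [← hv0] at this
      field_simp
      linear_combination κ * this) (m + 1) le_rfl).2
  have hy0 : 0 < y := by linarith
  -- Cancelling the weight y turns y^(m + 1) into y^m.
  have hB' : |b (m + 1) - κ * v (m + 1)| ≤ C₂ * r⁻¹ * y ^ m := by
    rw [pow_succ, ← mul_assoc, mul_comm] at hB
    exact le_of_mul_le_mul_right hB hy0
  have hym : y ^ m ≤ 1 + 1 / z ^ m := by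
    have : 0 < 1 / z ^ m := by positivity
    rcases max_choice 1 z⁻¹ with h | h
    · rw [hy, h, one_pow]; linarith
    · rw [hy, h, inv_pow, one_div]; linarith
  have hzm : 0 < 1 / z ^ m := by positivity
  calc |(a (m + 1) + b (m + 1)) - κ * (u (m + 1) + v (m + 1))|
      = |(a (m + 1) - κ * u (m + 1)) + (b (m + 1) - κ * v (m + 1))| := by
        congr 1
        ring
    _ ≤ C₁ * r⁻¹ + C₂ * r⁻¹ * y ^ m := (abs_add_le _ _).trans (add_le_add hA hB')
    _ ≤ C₁ * r⁻¹ * (1 + 1 / z ^ m) + C₂ * r⁻¹ * (1 + 1 / z ^ m) := by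
        refine add_le_add (le_mul_of_one_le_right (by positivity) (by linarith)) ?_
        exact mul_le_mul_of_nonneg_left hym (by positivity)
    _ = _ := by ring

end ErlangC

/-! ### Translation to the stationary law and the diffusion law. -/

theorem theorem5 (m : ℕ) (hm : 0 < m) :
    ∃ C : ℝ, ∀ (n : ℕ) (lam mu : ℝ), 1 ≤ n → 0 < lam → 0 < mu →
      1 ≤ ErlangC.load lam mu → ErlangC.load lam mu < n →
      ∀ π : Measure ℕ, ErlangC.IsStationaryLaw n lam mu π →
        IsProbabilityMeasure (ErlangC.diffusionLaw n lam mu) ∧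
        Integrable (fun x : ℝ => x ^ m) (ErlangC.scaledLaw lam mu π) ∧
        Integrable (fun x : ℝ => x ^ m) (ErlangC.diffusionLaw n lam mu) ∧
        |(∫ x, x ^ m ∂(ErlangC.scaledLaw lam mu π)) -
            ∫ x, x ^ m ∂(ErlangC.diffusionLaw n lam mu)| ≤
          (1 + 1 / |ErlangC.zeta n lam mu| ^ (m - 1)) * C * ErlangC.delta lam mu := by
  -- Writing m = k + 1 removes the truncated subtraction in the exponent m - 1.
  obtain ⟨k, rfl⟩ : ∃ k, m = k + 1 := ⟨m - 1, by omega⟩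
  obtain ⟨C, hC⟩ := ErlangC.exists_moment_bound k
  refine ⟨C, ?_⟩
  intro n lam mu _ _ hmu hload hn π hπ
  have : IsProbabilityMeasure π := hπ.1
  set r := √(ErlangC.load lam mu) with hrdef
  have hr2 : r ^ 2 = ErlangC.load lam mu := Real.sq_sqrt (by linarith)
  have hr : 1 ≤ r := Real.one_le_sqrt.2 hload
  have hr0 : 0 < r := by linarith
  have hn' : r ^ 2 < n := by rw [hr2]; exact hn
  have hz : 0 < ErlangC.node r n := div_pos (by linarith) hr0
  have hzeta : ErlangC.zeta n lam mu = -ErlangC.node r n := by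
    unfold ErlangC.zeta ErlangC.node
    rw [← hrdef, hr2]
    ring
  have hbal : ErlangC.Balanced n r fun i => π.real {i} := by
    intro i
    have h := hπ.detailed_balance hmu i
    simp only [ErlangC.deathRate] at h
    rw [hr2, ErlangC.load]
    field_simp
    linear_combination h
  have hnode : (fun i : ℕ => ((i : ℝ) - ErlangC.load lam mu) / √(ErlangC.load lam mu)) =
      ErlangC.node r := by
    ext i
    rw [ErlangC.node, hr2]
  have hmeas : AEMeasurable (ErlangC.node r) π := (measurable_of_countable _).aemeasurable
  have hpow : ∀ μ : Measure ℝ, AEStronglyMeasurable (fun x : ℝ => x ^ (k + 1)) μ := fun μ =>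
    (continuous_pow (k + 1)).aestronglyMeasurable
  obtain ⟨hi, he⟩ := hbal.moments hr0 hn' (k + 1)
  have hone := (hbal.moments hr0 hn' 0).2
  simp only [pow_zero, integral_const, probReal_univ, smul_eq_mul, mul_one] at hone
  obtain ⟨hi', he'⟩ := ErlangC.diffusionLaw_moments hmu hz hzeta (k + 1)
  refine ⟨ErlangC.isProbabilityMeasure_diffusionLaw hmu hz hzeta, ?_, hi', ?_⟩
  · rw [ErlangC.scaledLaw, hnode, integrable_map_measure (hpow _) hmeas]
    exact hi
  · rw [ErlangC.scaledLaw, hnode, integral_map hmeas (hpow _), he, he', hzeta, abs_neg,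
      abs_of_pos hz, Nat.add_sub_cancel, ErlangC.delta, ← hrdef, one_div r]
    exact hC n r _ hr hn' hbal hone.symm
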